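/- **Conventions.** A graph is a set with an involution $x\mapsto\bar x$ and a retraction $\tau$ onto the fixed points of the involution; fixed points are vertices, the other elements are oriented edges, and $\tau(e)$ is the terminal vertex of $e$. Graph morphisms are maps compatible with both operations (so edges may be collapsed to vertices). A graph of groups $(\Gamma,\mathscr G)$ is a connected graph $\Gamma$ with groups $\mathscr G_v$, $\mathscr G_e=\mathscr G_{\bar e}$ and monomorphisms $\iota_e\colon\mathscr G_e\to\mathscr G_{\tau(e)}$. A morphism $f\colon(\Lambda,\mathscr L)\to(\Gamma,\mathscr G)$ is a graph morphism $f\colon\Lambda\to\Gamma$, homomorphisms $f_v\colon\mathscr L_v\to\mathscr G_{f(v)}$ and $f_e=f_{\bar e}\colon\mathscr L_e\to\mathscr G_{f(e)}$, and elements $\delta_e\in\mathscr G_{f(\tau(e))}$, one for each oriented edge $e$, with $f_{\tau(e)}(\iota_e(h))=\delta_e\,\iota_{f(e)}(f_e(h))\,\delta_e^{-1}$ for $h\in\mathscr L_e$ (where $\iota_{f(e)}$ is the identity if $f(e)$ is a vertex). Paths $g_0e_1g_1\cdots e_kg_k$ in $(\Gamma,\mathscr G)$ are taken up to the homotopy generated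 by $\sigma\bar\sigma\simeq 1$ and $e\,\iota_e(h)\simeq\iota_{\bar e}(h)\,e$; $\pi_1(\Gamma,\mathscr G,q)$ is the group of homotopy classes of loops at the vertex $q$. A morphism acts on paths by $g\mapsto f_v(g)$ for $g\in\mathscr L_v$ and $e\mapsto\delta_{\bar e}f(e)\delta_e^{-1}$, and so induces $f_\sharp\colon\pi_1(\Lambda,\mathscr L,p)\to\pi_1(\Gamma,\mathscr G,f(p))$. The Bass–Serre tree $\tilde\Gamma$ based at $q$ has as vertices over $v$ the cosets $[\gamma]\mathscr G_v$ ($\gamma$ a path from $q$ to $v$) and as oriented edges over $e$ the cosets $[\gamma]\iota_e(\mathscr G_e)$ ($\gamma$ a path from $q$ to $\tau(e)$), with $\tau([\gamma]\iota_e(\mathscr G_e))=[\gamma]\mathscr G_{\tau(e)}$ and $\overline{[\gamma]\iota_e(\mathscr G_e)}=[\gamma\bar e]\iota_{\bar e}(\mathscr G_e)$; $\pi_1(\Gamma,\mathscr G,q)$ acts by left multiplication, and $\tilde q=[1]\mathscr G_q$ is the distinguished lift of $q$. A covering projection $\pi_\Gamma\colon\tilde\Gamma\to(\Gamma,\mathscr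 G)$ is a morphism of graphs of groups ($\tilde\Gamma$ carrying trivial groups) which is the obvious projection on graphs and such that, for every path $\eta$ in $\tilde\Gamma$ from $\tilde q$ to a vertex $\tilde v$ over $v$, one has $\tilde v=[\pi_\Gamma(\eta)]\mathscr G_v$, and every oriented edge $\tilde e$ over $e$ with $\tau(\tilde e)=\tilde v$ equals $[\pi_\Gamma(\eta)\delta_{\tilde e}]\iota_e(\mathscr G_e)$. **Theorem.** Let $(\Lambda,\mathscr L)$ and $(\Gamma,\mathscr G)$ be graphs of groups, $p$ a vertex of $\Lambda$ and $q$ a vertex of $\Gamma$. Let $\tilde\Lambda$, $\tilde\Gamma$ be the Bass–Serre trees based at $p$, $q$, with distinguished lifts $\tilde p,\tilde q$, and let $\pi_\Lambda$, $\pi_\Gamma$ be any covering projections. Given a morphism $f\colon(\Lambda,\mathscr L)\to(\Gamma,\mathscr G)$ and a graph morphism $\tilde f\colon\tilde\Lambda\to\tilde\Gamma$, say that $\tilde f$ *lifts* $f$ if $\tilde f(\tilde p)=\tilde q$ and the square $\pi_\Gamma\tilde f=f\pi_\Lambda$ commutes in the following sense: it commutes as a square of graph morphisms, and for every path $\eta$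 in $\tilde\Lambda$ from $\tilde p$ to a vertex $\tilde w$ lying over a vertex $w$ of $\Lambda$, the path $\pi_\Gamma(\tilde f(\eta))$ is homotopic rel endpoints to $f(\pi_\Lambda(\eta))\,g$ for some $g\in\mathscr G_{f(w)}$. 1. For every morphism $f\colon(\Lambda,\mathscr L)\to(\Gamma,\mathscr G)$ with $f(p)=q$ there is a unique graph morphism $\tilde f\colon\tilde\Lambda\to\tilde\Gamma$ that lifts $f$. It is $f_\sharp$-equivariant: $\tilde f(h.x)=f_\sharp(h).\tilde f(x)$ for all $h\in\pi_1(\Lambda,\mathscr L,p)$ and $x\in\tilde\Lambda$. 2. Conversely, let $\varphi\colon\pi_1(\Lambda,\mathscr L,p)\to\pi_1(\Gamma,\mathscr G,q)$ be a homomorphism and $\tilde f\colon\tilde\Lambda\to\tilde\Gamma$ a $\varphi$-equivariant graph morphism with $\tilde f(\tilde p)=\tilde q$. Then there is a morphism $f\colon(\Lambda,\mathscr L)\to(\Gamma,\mathscr G)$ with $f(p)=q$ and $f_\sharp=\varphi$ such that $\tilde f$ lifts $f$ (so that $\tilde f$ is the morphism induced by $f$ as in part 1). -/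

import Mathlib

universe u v u₁ v₁ u₂ v₂

namespace BassSerre

/-- A combinatorial graph: a set with an involution `bar` and a retraction `τ` of the set onto
the fixed points of the involution. The fixed points are the vertices, the other elements are the
oriented edges, `bar` reverses an edge and `τ` is the terminal vertex. -/
structure GerstenGraph where
  carrier : Type u
  bar : carrier → carrier
  τ : carrier → carrier
  bar_bar : ∀ x, bar (bar x) = x
  bar_τ : ∀ x, bar (τ x) = τ x
  τ_of_bar_eq : ∀ x, bar x = x → τ x = x

namespace GerstenGraph

/-- The vertices. -/
def Vert (Γ : GerstenGraph.{u}) : Type u := {x : Γ.carrier // Γ.bar x = x}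

/-- The terminal vertex `τ x`, as a vertex. -/
def tip (Γ : GerstenGraph.{u}) (x : Γ.carrier) : Γ.Vert := ⟨Γ.τ x, Γ.bar_τ x⟩

theorem tip_vert (Γ : GerstenGraph.{u}) (v : Γ.Vert) : Γ.tip v.1 = v :=
  Subtype.ext (Γ.τ_of_bar_eq v.1 v.2)

/-- The cells (vertices and unoriented edges): `e` and `bar e` are the same cell. -/
def Cell (Γ : GerstenGraph.{u}) : Type u := Quot fun x y : Γ.carrier => y = Γ.bar x

/-- The cell underlying a vertex or an oriented edge. -/
def cell (Γ : GerstenGraph.{u}) (x : Γ.carrier) : Γ.Cell := Quot.mk _ x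

theorem cell_bar (Γ : GerstenGraph.{u}) (x : Γ.carrier) : Γ.cell (Γ.bar x) = Γ.cell x :=
  (Quot.sound (r := fun x y : Γ.carrier => y = Γ.bar x) rfl).symm

/-- A vertex as a cell. -/
def Vert.cell {Γ : GerstenGraph.{u}} (v : Γ.Vert) : Γ.Cell := Γ.cell v.1

/-- Any two vertices are joined by an edge path. -/
def Connected (Γ : GerstenGraph.{u}) : Prop :=
  ∀ a b : Γ.Vert, Relation.ReflTransGen
    (fun a b : Γ.Vert => ∃ x, Γ.tip (Γ.bar x) = a ∧ Γ.tip x = b) a b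

end GerstenGraph

/-- A morphism of graphs: a map compatible with `bar` and `τ`. Vertices go to vertices; an edge
goes to an edge or is collapsed to a vertex. -/
@[ext]
structure GraphHom (Λ : GerstenGraph.{u₁}) (Γ : GerstenGraph.{u₂}) where
  toFun : Λ.carrier → Γ.carrier
  map_bar : ∀ x, toFun (Λ.bar x) = Γ.bar (toFun x)
  map_τ : ∀ x, toFun (Λ.τ x) = Γ.τ (toFun x)

namespace GraphHom

variable {Λ : GerstenGraph.{u₁}} {Γ : GerstenGraph.{u₂}}

/-- The map on vertices. -/
def vert (f : GraphHom Λ Γ) (v : Λ.Vert) : Γ.Vert :=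
  ⟨f.toFun v.1, by rw [← f.map_bar, v.2]⟩

/-- The map on cells. -/
def cell (f : GraphHom Λ Γ) : Λ.Cell → Γ.Cell :=
  Quot.map f.toFun (by rintro x y rfl; exact f.map_bar x)

theorem cell_map (f : GraphHom Λ Γ) {x : Λ.carrier} {c : Λ.Cell} (h : Λ.cell x = c) :
    Γ.cell (f.toFun x) = f.cell c := by
  subst h; rfl

theorem tip_map (f : GraphHom Λ Γ) {x : Λ.carrier} {v : Λ.Vert} (h : Λ.tip x = v) :
    Γ.tip (f.toFun x) = f.vert v := by
  subst h; exact Subtype.ext (f.map_τ x).symm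

theorem tip_bar_map (f : GraphHom Λ Γ) {x : Λ.carrier} {v : Λ.Vert}
    (h : Λ.tip (Λ.bar x) = v) : Γ.tip (Γ.bar (f.toFun x)) = f.vert v := by
  rw [← f.map_bar]; exact f.tip_map h

end GraphHom

/-- A diagram of groups and monomorphisms in the shape of the graph `Γ`: one group for each cell,
and for `x` with underlying cell `c` and terminal vertex `v` a monomorphism
`ι x : grp c → grp v`. In particular `ι e` and `ι (bar e)` are defined on the same edge group.
For a vertex `v`, `ι v` is the identity (the functor preserves identities).
A graph of groups is such a diagram on a *connected* graph; connectedness is a separate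
hypothesis. -/
structure GraphOfGroups (Γ : GerstenGraph.{u}) where
  grp : Γ.Cell → Type v
  [group : ∀ c, Group (grp c)]
  ι : ∀ (x : Γ.carrier) {c : Γ.Cell} {v : Γ.Vert}, Γ.cell x = c → Γ.tip x = v →
    (grp c →* grp v.cell)
  ι_injective : ∀ (x : Γ.carrier) {c : Γ.Cell} {v : Γ.Vert} (hc : Γ.cell x = c)
    (hv : Γ.tip x = v), Function.Injective (ι x hc hv)
  ι_vert : ∀ v : Γ.Vert, ι v.1 (c := v.cell) rfl (Γ.tip_vert v) = MonoidHom.id _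

attribute [instance] GraphOfGroups.group

/-- An ordinary graph, with trivial groups. -/
def GraphOfGroups.trivial (Γ : GerstenGraph.{u}) : GraphOfGroups.{u, 0} Γ where
  grp := fun _ => Unit
  ι := fun _ _ _ _ _ => 1
  ι_injective := fun _ _ _ _ _ _ _ _ => rfl
  ι_vert := fun _ => rfl

/-- A morphism of graphs of groups: a morphism of graphs, homomorphisms
of the vertex and edge groups, and for every oriented edge `e` with `τ e = v` an element `δ e` of
the group at `f v` such that `f_v (ι_e h) = δ_e * ι_{f e} (f_e h) * δ_e⁻¹`.
If `f e` is a vertex then `ι_{f e}` is the identity. For a vertex `v`, `δ v` is `1`. -/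
structure Morphism {Λ : GerstenGraph.{u₁}} {Γ : GerstenGraph.{u₂}}
    (L : GraphOfGroups.{u₁, v₁} Λ) (G : GraphOfGroups.{u₂, v₂} Γ) where
  graph : GraphHom Λ Γ
  hom : ∀ c : Λ.Cell, L.grp c →* G.grp (graph.cell c)
  δ : ∀ (x : Λ.carrier) {v : Λ.Vert}, Λ.tip x = v → G.grp (graph.vert v).cell
  δ_vert : ∀ v : Λ.Vert, δ v.1 (Λ.tip_vert v) = 1
  pseudonatural : ∀ (x : Λ.carrier) {c : Λ.Cell} {v : Λ.Vert} (hc : Λ.cell x = c)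
    (hv : Λ.tip x = v) (h : L.grp c),
    (hom v.cell (L.ι x hc hv h) : G.grp (graph.vert v).cell) =
      δ x hv * G.ι (graph.toFun x) (graph.cell_map hc) (graph.tip_map hv) (hom c h) * (δ x hv)⁻¹

/-- A morphism of graphs as a morphism of trivial graphs of groups. -/
def GraphHom.toMorphism {Λ : GerstenGraph.{u₁}} {Γ : GerstenGraph.{u₂}} (f : GraphHom Λ Γ) :
    Morphism (GraphOfGroups.trivial Λ) (GraphOfGroups.trivial Γ) where
  graph := f
  hom := fun _ => 1
  δ := fun _ _ _ => 1
  δ_vert := fun _ => rfl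
  pseudonatural := fun _ _ _ _ _ _ => rfl

/-- Paths `g₀ e₁ g₁ e₂ ⋯ e_k g_k` in a graph of groups, with endpoints at vertices: `base g` is
the path `g` without edges, and `cons g e γ` is `g e γ`. A letter `e` that is a vertex is
allowed and stands for a constant segment, which `Homotopic.const` removes. -/
inductive GPath {Γ : GerstenGraph.{u}} (G : GraphOfGroups.{u, v} Γ) :
    Γ.Vert → Γ.Vert → Type (max u v)
  | base {a : Γ.Vert} (g : G.grp a.cell) : GPath G a a
  | cons {a b c : Γ.Vert} (g : G.grp a.cell) (x : Γ.carrier) (ha : Γ.tip (Γ.bar x) = a)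
      (hb : Γ.tip x = b) (γ : GPath G b c) : GPath G a c

namespace GPath

variable {Γ : GerstenGraph.{u}} {G : GraphOfGroups.{u, v} Γ}

/-- Multiply the first group element on the left. -/
def lmul {a b : Γ.Vert} (g : G.grp a.cell) : GPath G a b → GPath G a b
  | base h => base (g * h)
  | cons h x ha hb γ => cons (g * h) x ha hb γ

/-- Concatenation; the adjacent group elements are multiplied. -/
def append {a b c : Γ.Vert} : GPath G a b → GPath G b c → GPath G a c
  | base g, η => lmul g η
  | cons g x ha hb γ, η => cons g x ha hb (append γ η)

/-- The path `e` from `τ (bar e)` to `τ e`. -/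
def edge {a b : Γ.Vert} (x : Γ.carrier) (ha : Γ.tip (Γ.bar x) = a) (hb : Γ.tip x = b) :
    GPath G a b := cons 1 x ha hb (base 1)

/-- The reversed path. -/
def reverse {a b : Γ.Vert} : GPath G a b → GPath G b a
  | base g => base g⁻¹
  | cons g x ha hb γ =>
      (reverse γ).append (cons 1 (Γ.bar x) (by rw [Γ.bar_bar]; exact hb) ha (base g⁻¹))

/-- Transport of a path along equalities of its endpoints. -/
def copy {a b a' b' : Γ.Vert} (γ : GPath G a b) (ha : a = a') (hb : b = b') : GPath G a' b' :=
  ha ▸ hb ▸ γ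

end GPath

/-- Homotopy of paths rel endpoints: the congruence generated by deleting `σ σ̄`, by
`e ι_e(h) ≃ ι_{bar e}(h) e`, and by deleting constant segments. -/
inductive Homotopic {Γ : GerstenGraph.{u}} {G : GraphOfGroups.{u, v} Γ} :
    {a b : Γ.Vert} → GPath G a b → GPath G a b → Prop
  | refl {a b : Γ.Vert} (γ : GPath G a b) : Homotopic γ γ
  | symm {a b : Γ.Vert} {γ η : GPath G a b} : Homotopic γ η → Homotopic η γ
  | trans {a b : Γ.Vert} {γ η θ : GPath G a b} :
      Homotopic γ η → Homotopic η θ → Homotopic γ θ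
  | append {a b c : Γ.Vert} {γ γ' : GPath G a b} {η η' : GPath G b c} :
      Homotopic γ γ' → Homotopic η η' → Homotopic (γ.append η) (γ'.append η')
  | cancel {a b : Γ.Vert} (σ : GPath G a b) :
      Homotopic (σ.append σ.reverse) (GPath.base 1)
  | slide {a b : Γ.Vert} (x : Γ.carrier) {c : Γ.Cell} (hc : Γ.cell x = c)
      (ha : Γ.tip (Γ.bar x) = a) (hb : Γ.tip x = b) (h : G.grp c) :
      Homotopic (GPath.cons 1 x ha hb (GPath.base (G.ι x hc hb h)))
        (GPath.cons (G.ι (Γ.bar x) ((Γ.cell_bar x).trans hc) ha h) x ha hb (GPath.base 1))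
  | const (w : Γ.Vert) :
      Homotopic (GPath.edge w.1 (by rw [w.2]; exact Γ.tip_vert w) (Γ.tip_vert w))
        (GPath.base (G := G) (a := w) 1)

namespace GPath

variable {Γ : GerstenGraph.{u}} {G : GraphOfGroups.{u, v} Γ}

theorem lmul_one {a b : Γ.Vert} (γ : GPath G a b) : lmul 1 γ = γ := by
  cases γ <;> simp [lmul]

theorem lmul_lmul {a b : Γ.Vert} (g h : G.grp a.cell) (γ : GPath G a b) :
    lmul g (lmul h γ) = lmul (g * h) γ := by
  cases γ <;> simp [lmul, mul_assoc]

theorem lmul_append {a b c : Γ.Vert} (g : G.grp a.cell) (γ : GPath G a b) (η : GPath G b c) :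
    (lmul g γ).append η = lmul g (γ.append η) := by
  cases γ
  · exact (lmul_lmul _ _ _).symm
  · rfl

theorem append_assoc {a b c d : Γ.Vert} (γ : GPath G a b) (η : GPath G b c) (θ : GPath G c d) :
    (γ.append η).append θ = γ.append (η.append θ) := by
  induction γ with
  | base g => simp [append, lmul_append]
  | cons g x ha hb γ ih => simp [append, ih]

theorem append_base_one {a b : Γ.Vert} (γ : GPath G a b) : γ.append (base 1) = γ := by
  induction γ with
  | base g => simp [append, lmul]
  | cons g x ha hb γ ih => simp [append, ih]

theorem reverse_lmul {a b : Γ.Vert} (g : G.grp a.cell) (γ : GPath G a b) :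
    (lmul g γ).reverse = γ.reverse.append (base g⁻¹) := by
  cases γ <;> simp [lmul, reverse, append, append_assoc]

theorem reverse_append {a b c : Γ.Vert} (γ : GPath G a b) (η : GPath G b c) :
    (γ.append η).reverse = η.reverse.append γ.reverse := by
  induction γ with
  | base g => simp [append, reverse_lmul, reverse]
  | cons g x ha hb γ ih => simp [append, reverse, ih, append_assoc]

theorem cons_congr {a b c : Γ.Vert} (g : G.grp a.cell) {x y : Γ.carrier} (h : x = y)
    (ha : Γ.tip (Γ.bar x) = a) (hb : Γ.tip x = b) (ha' : Γ.tip (Γ.bar y) = a)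
    (hb' : Γ.tip y = b) (γ : GPath G b c) : cons g x ha hb γ = cons g y ha' hb' γ := by
  subst h; rfl

theorem reverse_reverse {a b : Γ.Vert} (γ : GPath G a b) : γ.reverse.reverse = γ := by
  induction γ with
  | base g => simp [reverse]
  | cons g x ha hb γ ih =>
    rw [reverse, reverse_append, ih]
    change cons (g⁻¹⁻¹ * 1) _ _ _ (lmul 1⁻¹ γ) = _
    rw [inv_one, lmul_one, inv_inv, mul_one]
    exact cons_congr _ (Γ.bar_bar x) _ _ _ _ _

end GPath

/-- Homotopy classes rel endpoints of paths from `a` to `b`. -/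
def PathClass {Γ : GerstenGraph.{u}} (G : GraphOfGroups.{u, v} Γ) (a b : Γ.Vert) :
    Type (max u v) :=
  Quotient (⟨Homotopic, Homotopic.refl, Homotopic.symm, Homotopic.trans⟩ : Setoid (GPath G a b))

namespace PathClass

variable {Γ : GerstenGraph.{u}} {G : GraphOfGroups.{u, v} Γ}

/-- The class of a path. -/
def mk {a b : Γ.Vert} (γ : GPath G a b) : PathClass G a b := Quotient.mk _ γ

theorem sound {a b : Γ.Vert} {γ η : GPath G a b} (h : Homotopic γ η) : mk γ = mk η :=
  Quotient.sound h

theorem exact {a b : Γ.Vert} {γ η : GPath G a b} (h : mk γ = mk η) : Homotopic γ η :=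
  Quotient.exact h

theorem ind {a b : Γ.Vert} {P : PathClass G a b → Prop} (h : ∀ γ, P (mk γ)) (γ) : P γ :=
  Quotient.ind h γ

/-- Concatenation of classes. -/
def comp {a b c : Γ.Vert} : PathClass G a b → PathClass G b c → PathClass G a c :=
  Quotient.map₂ GPath.append fun _ _ h _ _ h' => Homotopic.append h h'

/-- The class of the path consisting of a single vertex group element. -/
def of {a : Γ.Vert} (g : G.grp a.cell) : PathClass G a a := mk (GPath.base g)

/-- The class of a single edge. -/
def edge {a b : Γ.Vert} (x : Γ.carrier) (ha : Γ.tip (Γ.bar x) = a) (hb : Γ.tip x = b) :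
    PathClass G a b := mk (GPath.edge x ha hb)

theorem mk_comp {a b c : Γ.Vert} (γ : GPath G a b) (η : GPath G b c) :
    (mk γ).comp (mk η) = mk (γ.append η) := rfl

theorem comp_assoc {a b c d : Γ.Vert} (γ : PathClass G a b) (η : PathClass G b c)
    (θ : PathClass G c d) : (γ.comp η).comp θ = γ.comp (η.comp θ) := by
  induction γ using ind; induction η using ind; induction θ using ind
  simp [mk_comp, GPath.append_assoc]

theorem of_one_comp {a b : Γ.Vert} (γ : PathClass G a b) : (of 1).comp γ = γ := by
  induction γ using ind
  simp [of, mk_comp, GPath.append, GPath.lmul_one]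

theorem comp_of_one {a b : Γ.Vert} (γ : PathClass G a b) : γ.comp (of 1) = γ := by
  induction γ using ind
  simp [of, mk_comp, GPath.append_base_one]

theorem mk_comp_reverse {a b : Γ.Vert} (γ : GPath G a b) :
    (mk γ).comp (mk γ.reverse) = of 1 := sound (Homotopic.cancel γ)

theorem mk_reverse_comp {a b : Γ.Vert} (γ : GPath G a b) :
    (mk γ.reverse).comp (mk γ) = of 1 := by
  have h := mk_comp_reverse γ.reverse
  rwa [GPath.reverse_reverse] at h

/-- The class of the reversed path. -/
def inv {a b : Γ.Vert} : PathClass G a b → PathClass G b a :=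
  Quotient.lift (fun γ => mk γ.reverse) fun γ η h => by
    have h' : mk γ = mk η := sound h
    calc mk γ.reverse = (mk γ.reverse).comp ((mk η).comp (mk η.reverse)) := by
          rw [mk_comp_reverse, comp_of_one]
      _ = mk η.reverse := by rw [← h', ← comp_assoc, mk_reverse_comp, of_one_comp]

theorem inv_comp {a b : Γ.Vert} (γ : PathClass G a b) : γ.inv.comp γ = of 1 := by
  induction γ using ind with | _ γ => exact mk_reverse_comp γ

theorem comp_inv {a b : Γ.Vert} (γ : PathClass G a b) : γ.comp γ.inv = of 1 := by
  induction γ using ind with | _ γ => exact mk_comp_reverse γ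

theorem of_comp_of {a : Γ.Vert} (g h : G.grp a.cell) : (of g).comp (of h) = of (g * h) := rfl

theorem edge_comp_edge_bar {a b : Γ.Vert} (x y : Γ.carrier) (hy : y = Γ.bar x)
    (ha : Γ.tip (Γ.bar x) = a) (hb : Γ.tip x = b) (hb' : Γ.tip (Γ.bar y) = b)
    (ha' : Γ.tip y = a) :
    (edge x ha hb : PathClass G a b).comp (edge y hb' ha') = of 1 := by
  subst hy
  have h := mk_comp_reverse (GPath.edge x ha hb : GPath G a b)
  simpa [GPath.edge, GPath.reverse, GPath.append, GPath.lmul, edge] using h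

theorem slide {a b : Γ.Vert} (x : Γ.carrier) {c : Γ.Cell} (hc : Γ.cell x = c)
    (ha : Γ.tip (Γ.bar x) = a) (hb : Γ.tip x = b) (h : G.grp c) :
    (edge x ha hb : PathClass G a b).comp (of (G.ι x hc hb h)) =
      (of (G.ι (Γ.bar x) ((Γ.cell_bar x).trans hc) ha h)).comp (edge x ha hb) := by
  have := sound (Homotopic.slide (G := G) x hc ha hb h)
  simpa [edge, of, mk_comp, GPath.edge, GPath.append, GPath.lmul] using this

/-- Transport of a class along equalities of its endpoints. -/
def copy {a b a' b' : Γ.Vert} (γ : PathClass G a b) (ha : a = a') (hb : b = b') :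
    PathClass G a' b' := ha ▸ hb ▸ γ

end PathClass

/-- The fundamental group `π₁(Γ, G, p)`: homotopy classes of loops based at `p`, under
concatenation. -/
abbrev PiOne {Γ : GerstenGraph.{u}} (G : GraphOfGroups.{u, v} Γ) (p : Γ.Vert) :
    Type (max u v) := PathClass G p p

instance PiOne.instGroup {Γ : GerstenGraph.{u}} (G : GraphOfGroups.{u, v} Γ) (p : Γ.Vert) :
    Group (PiOne G p) where
  mul := PathClass.comp
  one := PathClass.of 1
  inv := PathClass.inv
  mul_assoc := PathClass.comp_assoc
  one_mul := PathClass.of_one_comp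
  mul_one := PathClass.comp_of_one
  inv_mul_cancel := PathClass.inv_comp

namespace Morphism

variable {Λ : GerstenGraph.{u₁}} {Γ : GerstenGraph.{u₂}}
  {L : GraphOfGroups.{u₁, v₁} Λ} {G : GraphOfGroups.{u₂, v₂} Γ}

/-- The homomorphism `f_v` of vertex groups. -/
def vhom (f : Morphism L G) (a : Λ.Vert) : L.grp a.cell →* G.grp (f.graph.vert a).cell :=
  f.hom a.cell

/-- The action on paths: `g ∈ L_v` goes to `f_v g` and `e` goes to `δ_{bar e} (f e) δ_e⁻¹`. -/
def mapPath (f : Morphism L G) {a b : Λ.Vert} :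
    GPath L a b → GPath G (f.graph.vert a) (f.graph.vert b)
  | .base g => .base (f.vhom _ g)
  | .cons g x ha hb γ =>
      .cons (f.vhom _ g * f.δ (Λ.bar x) ha) (f.graph.toFun x) (f.graph.tip_bar_map ha)
        (f.graph.tip_map hb) (GPath.lmul (f.δ x hb)⁻¹ (mapPath f γ))

theorem mapPath_lmul (f : Morphism L G) {a b : Λ.Vert} (g : L.grp a.cell) (γ : GPath L a b) :
    f.mapPath (GPath.lmul g γ) = GPath.lmul (f.vhom _ g) (f.mapPath γ) := by
  cases γ <;> simp [GPath.lmul, mapPath, mul_assoc]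

theorem mapPath_append (f : Morphism L G) {a b c : Λ.Vert} (γ : GPath L a b)
    (η : GPath L b c) : f.mapPath (γ.append η) = (f.mapPath γ).append (f.mapPath η) := by
  induction γ with
  | base g => simp only [GPath.append, mapPath, mapPath_lmul]
  | cons g x ha hb γ ih => simp only [GPath.append, mapPath, ih, GPath.lmul_append]

theorem δ_congr (f : Morphism L G) {x y : Λ.carrier} (h : x = y) {v : Λ.Vert}
    (hx : Λ.tip x = v) (hy : Λ.tip y = v) : f.δ x hx = f.δ y hy := by
  subst h; rfl

theorem mk_mapPath_cons (f : Morphism L G) {a b c : Λ.Vert} (g : L.grp a.cell) (x : Λ.carrier)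
    (ha : Λ.tip (Λ.bar x) = a) (hb : Λ.tip x = b) (γ : GPath L b c) :
    PathClass.mk (f.mapPath (.cons g x ha hb γ)) =
      (PathClass.of (f.vhom _ g)).comp ((PathClass.of (f.δ (Λ.bar x) ha)).comp
        ((PathClass.edge (f.graph.toFun x) (f.graph.tip_bar_map ha) (f.graph.tip_map hb)).comp
          ((PathClass.of (f.δ x hb)⁻¹).comp (PathClass.mk (f.mapPath γ))))) := by
  change _ = PathClass.mk (GPath.cons (_ * (_ * 1)) _ _ _ (GPath.lmul 1 (GPath.lmul _ _)))
  rw [mul_one, GPath.lmul_one]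
  rfl

theorem mk_mapPath_reverse (f : Morphism L G) {a b : Λ.Vert} (γ : GPath L a b) :
    (PathClass.mk (f.mapPath γ)).comp (PathClass.mk (f.mapPath γ.reverse)) =
      PathClass.of 1 := by
  have key : ∀ {a b : Γ.Vert} (g : G.grp a.cell) (η : PathClass G a b),
      (PathClass.of g⁻¹).comp ((PathClass.of g).comp η) = η := fun g η => by
    rw [← PathClass.comp_assoc, PathClass.of_comp_of, inv_mul_cancel, PathClass.of_one_comp]
  have key' : ∀ {a b : Γ.Vert} (g : G.grp a.cell) (η : PathClass G a b),
      (PathClass.of g).comp ((PathClass.of g⁻¹).comp η) = η := fun g η => by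
    rw [← PathClass.comp_assoc, PathClass.of_comp_of, mul_inv_cancel, PathClass.of_one_comp]
  induction γ with
  | base g =>
    simp only [GPath.reverse, mapPath, map_inv]
    exact (PathClass.of_comp_of _ _).trans (by rw [mul_inv_cancel])
  | @cons a b c g x ha hb γ ih =>
    have hx : f.graph.toFun (Λ.bar x) = Γ.bar (f.graph.toFun x) := f.graph.map_bar x
    rw [GPath.reverse, mapPath_append, ← PathClass.mk_comp, mk_mapPath_cons, mk_mapPath_cons]
    simp only [PathClass.comp_assoc]
    rw [← PathClass.comp_assoc (PathClass.mk (f.mapPath γ)), ih, PathClass.of_one_comp, map_one,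
      PathClass.of_one_comp, f.δ_congr (Λ.bar_bar x) _ hb, key,
      ← PathClass.comp_assoc (PathClass.edge _ _ _),
      PathClass.edge_comp_edge_bar _ _ hx, PathClass.of_one_comp, key']
    change (PathClass.of _).comp (PathClass.of _) = _
    rw [PathClass.of_comp_of, map_inv, mul_inv_cancel]

theorem mapPath_homotopic (f : Morphism L G) {a b : Λ.Vert} {γ η : GPath L a b}
    (h : Homotopic γ η) : Homotopic (f.mapPath γ) (f.mapPath η) := by
  induction h with
  | refl γ => exact .refl _
  | symm _ ih => exact ih.symm
  | trans _ _ ih ih' => exact ih.trans ih'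
  | append _ _ ih ih' => rw [mapPath_append, mapPath_append]; exact ih.append ih'
  | cancel σ =>
    apply PathClass.exact
    rw [mapPath_append, ← PathClass.mk_comp, mk_mapPath_reverse]
    simp only [mapPath, map_one]; rfl
  | @slide a b x c hc ha hb h =>
    apply PathClass.exact
    have key : ∀ {a b : Γ.Vert} (g : G.grp a.cell) (η : PathClass G a b),
        (PathClass.of g⁻¹).comp ((PathClass.of g).comp η) = η := fun g η => by
      rw [← PathClass.comp_assoc, PathClass.of_comp_of, inv_mul_cancel, PathClass.of_one_comp]
    have hι : ∀ {y z : Γ.carrier} (e : y = z) {c : Γ.Cell} {v : Γ.Vert} (hc : Γ.cell y = c)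
        (hv : Γ.tip y = v) (hc' : Γ.cell z = c) (hv' : Γ.tip z = v) (k : G.grp c),
        G.ι y hc hv k = G.ι z hc' hv' k := by
      rintro y z rfl; intros; rfl
    have h1 : f.vhom b (L.ι x hc hb h) = f.δ x hb * G.ι (f.graph.toFun x) (f.graph.cell_map hc)
        (f.graph.tip_map hb) (f.hom _ h) * (f.δ x hb)⁻¹ := f.pseudonatural x hc hb h
    have hc' := (Λ.cell_bar x).trans hc
    have h2 : f.vhom a (L.ι (Λ.bar x) hc' ha h) = f.δ (Λ.bar x) ha *
        G.ι (Γ.bar (f.graph.toFun x)) ((Γ.cell_bar _).trans (f.graph.cell_map hc))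
          (f.graph.tip_bar_map ha) (f.hom _ h) * (f.δ (Λ.bar x) ha)⁻¹ := by
      rw [← hι (f.graph.map_bar x) (f.graph.cell_map hc') (f.graph.tip_map ha)]
      exact f.pseudonatural (Λ.bar x) hc' ha h
    rw [mk_mapPath_cons, mk_mapPath_cons]
    have e1 : PathClass.mk (f.mapPath (GPath.base (L.ι x hc hb h))) =
      PathClass.of (f.vhom b (L.ι x hc hb h)) := rfl
    have e2 : PathClass.mk (f.mapPath (GPath.base (1 : L.grp b.cell))) =
      PathClass.of (f.vhom b 1) := rfl
    rw [e1, e2, h1, h2]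
    simp only [map_one, PathClass.of_one_comp, PathClass.comp_of_one, ← PathClass.of_comp_of,
      PathClass.comp_assoc, key]
    rw [← PathClass.comp_assoc (PathClass.edge _ _ _), PathClass.slide, PathClass.comp_assoc]
  | const w =>
    apply PathClass.exact
    have e2 : PathClass.mk (f.mapPath (GPath.base (1 : L.grp w.cell))) =
      PathClass.of (f.vhom w 1) := rfl
    have e3 := PathClass.sound (Homotopic.const (G := G) (f.graph.vert w))
    change PathClass.edge (f.graph.toFun w.1) _ _ = PathClass.of 1 at e3
    rw [GPath.edge, mk_mapPath_cons, e2, f.δ_congr w.2 _ (Λ.tip_vert w), f.δ_vert]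
    simp only [map_one, PathClass.of_one_comp, PathClass.comp_of_one, inv_one]
    exact e3

/-- The map on homotopy classes of paths. -/
def mapClass (f : Morphism L G) {a b : Λ.Vert} :
    PathClass L a b → PathClass G (f.graph.vert a) (f.graph.vert b) :=
  Quotient.map f.mapPath fun _ _ h => f.mapPath_homotopic h

/-- The induced homomorphism `f_♯ : π₁(Λ, L, p) → π₁(Γ, G, q)`, where `f p = q`. -/
def piOne (f : Morphism L G) {p : Λ.Vert} {q : Γ.Vert} (hpq : f.graph.vert p = q) :
    PiOne L p →* PiOne G q where
  toFun γ := (f.mapClass γ).copy hpq hpq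
  map_one' := by
    subst hpq
    change PathClass.of (f.vhom p 1) = PathClass.of 1
    rw [map_one]
  map_mul' γ η := by
    subst hpq
    induction γ using PathClass.ind with | _ γ
    induction η using PathClass.ind with | _ η
    exact congrArg PathClass.mk (f.mapPath_append γ η)

end Morphism

section Tree

variable {Γ : GerstenGraph.{u}} (G : GraphOfGroups.{u, v} Γ) (p : Γ.Vert)

/-- A representative `(x, γ)` of a cell of the Bass–Serre tree: `x` is a vertex or an oriented
edge of `Γ`, and `γ` is a class of paths from `p` to `v = τ x`. -/
structure PreCell where
  x : Γ.carrier
  v : Γ.Vert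
  hv : Γ.tip x = v
  γ : PathClass G p v

/-- `(x, γ)` and `(x, γ ι_x(h))` represent the same cell. -/
inductive PreCell.Rel : PreCell G p → PreCell G p → Prop
  | mk (x : Γ.carrier) {c : Γ.Cell} {v : Γ.Vert} (hc : Γ.cell x = c) (hv : Γ.tip x = v)
      (γ : PathClass G p v) (h : G.grp c) :
      PreCell.Rel ⟨x, v, hv, γ⟩ ⟨x, v, hv, γ.comp (PathClass.of (G.ι x hc hv h))⟩

/-- The cells of the Bass–Serre tree: over a vertex `v` the cosets `γ G_v` of classes `γ` of paths
from `p` to `v`, over an oriented edge `e` the cosets `γ ι_e(G_e)` of classes `γ` of paths from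
`p` to `τ e`. -/
def TreeCell : Type (max u v) := Quot (PreCell.Rel G p)

variable {G p}

/-- The cell represented by `(x, γ)`. -/
def TreeCell.mk (x : Γ.carrier) {v : Γ.Vert} (hv : Γ.tip x = v) (γ : PathClass G p v) :
    TreeCell G p := Quot.mk _ ⟨x, v, hv, γ⟩

theorem TreeCell.sound (x : Γ.carrier) {c : Γ.Cell} {v : Γ.Vert} (hc : Γ.cell x = c)
    (hv : Γ.tip x = v) (γ : PathClass G p v) (h : G.grp c) :
    TreeCell.mk x hv (γ.comp (PathClass.of (G.ι x hc hv h))) = TreeCell.mk x hv γ :=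
  (Quot.sound (PreCell.Rel.mk x hc hv γ h)).symm

theorem TreeCell.mk_congr {x y : Γ.carrier} (h : x = y) {v : Γ.Vert} (hx : Γ.tip x = v)
    (hy : Γ.tip y = v) (γ : PathClass G p v) : TreeCell.mk x hx γ = TreeCell.mk y hy γ := by
  subst h; rfl

theorem TreeCell.ind {P : TreeCell G p → Prop}
    (h : ∀ (x : Γ.carrier) (v : Γ.Vert) (hv : Γ.tip x = v) (γ : PathClass G p v),
      P (TreeCell.mk x hv γ)) (t) : P t :=
  Quot.ind (fun a => h a.x a.v a.hv a.γ) t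

/-- The projection of cells to `Γ`. -/
def TreeCell.proj : TreeCell G p → Γ.carrier :=
  Quot.lift (fun a => a.x) (by rintro _ _ ⟨⟩; rfl)

/-- The terminal vertex of `γ ι_e(G_e)` is `γ G_{τ e}`. -/
def TreeCell.τ : TreeCell G p → TreeCell G p :=
  Quot.lift (fun a => TreeCell.mk a.v.1 (Γ.tip_vert a.v) a.γ) (by
    rintro _ _ ⟨x, hc, hv, γ, h⟩
    have := TreeCell.sound (G := G) _ rfl (Γ.tip_vert _) γ (G.ι x hc hv h)
    have e : ∀ {v : Γ.Vert} (k : G.grp v.cell), G.ι v.1 rfl (Γ.tip_vert v) k = k :=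
      fun {v} k => DFunLike.congr_fun (G.ι_vert v) k
    exact (e (G.ι x hc hv h) ▸ this).symm)

/-- The reverse of `γ ι_e(G_e)` is `γ ē ι_{bar e}(G_e)`. -/
def TreeCell.bar : TreeCell G p → TreeCell G p :=
  Quot.lift (fun a => TreeCell.mk (Γ.bar a.x) rfl
      (a.γ.comp (PathClass.edge (Γ.bar a.x) (by rw [Γ.bar_bar]; exact a.hv) rfl))) (by
    rintro _ _ ⟨x, hc, hv, γ, h⟩
    have hc' := (Γ.cell_bar x).trans hc
    have hι : ∀ {y z : Γ.carrier} (e : y = z) {c : Γ.Cell} {v : Γ.Vert} (hc : Γ.cell y = c)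
        (hv : Γ.tip y = v) (hc' : Γ.cell z = c) (hv' : Γ.tip z = v) (k : G.grp c),
        G.ι y hc hv k = G.ι z hc' hv' k := by
      rintro y z rfl; intros; rfl
    have hv' : Γ.tip (Γ.bar (Γ.bar x)) = _ := (congrArg Γ.tip (Γ.bar_bar x)).trans hv
    have := TreeCell.sound (G := G) (Γ.bar x) hc' rfl
      (γ.comp (PathClass.edge (Γ.bar x) hv' rfl)) h
    rw [PathClass.comp_assoc, PathClass.slide (Γ.bar x) hc' hv' rfl h,
      hι (Γ.bar_bar x) _ _ hc hv, ← PathClass.comp_assoc] at this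
    exact this.symm)

theorem TreeCell.bar_mk {x y : Γ.carrier} (hy : y = Γ.bar x) {v w : Γ.Vert}
    (hv : Γ.tip x = v) (hb : Γ.tip (Γ.bar y) = v) (hw : Γ.tip y = w) (γ : PathClass G p v) :
    (TreeCell.mk x hv γ).bar = TreeCell.mk y hw (γ.comp (PathClass.edge y hb hw)) := by
  subst hy hw; rfl

theorem PathClass.edge_of_vertex {x : Γ.carrier} (hx : Γ.bar x = x) {a : Γ.Vert}
    (ha : Γ.tip (Γ.bar x) = a) (hb : Γ.tip x = a) :
    (PathClass.edge x ha hb : PathClass G a a) = PathClass.of 1 := by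
  have h : (⟨x, hx⟩ : Γ.Vert) = a := (Γ.tip_vert ⟨x, hx⟩).symm.trans hb
  subst h
  exact PathClass.sound (Homotopic.const (G := G) ⟨x, hx⟩)

variable (G p)

/-- The Bass–Serre tree `Γ̃` of `(Γ, G)` with respect to the basepoint `p`. -/
def tree : GerstenGraph.{max u v} where
  carrier := TreeCell G p
  bar := TreeCell.bar
  τ := TreeCell.τ
  bar_bar t := by
    induction t using TreeCell.ind with | _ x v hv γ
    have hv' : Γ.tip (Γ.bar (Γ.bar x)) = v := (congrArg Γ.tip (Γ.bar_bar x)).trans hv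
    rw [TreeCell.bar_mk rfl hv hv' rfl, TreeCell.bar_mk (Γ.bar_bar x).symm rfl rfl hv,
      PathClass.comp_assoc, PathClass.edge_comp_edge_bar _ _ (Γ.bar_bar x).symm,
      PathClass.comp_of_one]
  bar_τ t := by
    induction t using TreeCell.ind with | _ x v hv γ
    have h := TreeCell.bar_mk v.2.symm (Γ.tip_vert v) ((congrArg Γ.tip v.2).trans (Γ.tip_vert v))
      (Γ.tip_vert v) γ
    rw [PathClass.edge_of_vertex v.2, PathClass.comp_of_one] at h
    exact h
  τ_of_bar_eq t ht := by
    induction t using TreeCell.ind with | _ x v hv γ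
    have hx : Γ.bar x = x := congrArg TreeCell.proj ht
    have : x = v.1 := by rw [← hv]; exact (Γ.τ_of_bar_eq x hx).symm
    exact TreeCell.mk_congr this.symm _ _ _

/-- The distinguished lift `p̃` of `p`. -/
def treeRoot : (tree G p).Vert :=
  ⟨TreeCell.mk p.1 (Γ.tip_vert p) (PathClass.of 1),
    (tree G p).bar_τ (TreeCell.mk p.1 (Γ.tip_vert p) (PathClass.of 1))⟩

/-- The projection `Γ̃ → Γ` as a morphism of graphs. -/
def treeProj : GraphHom (tree G p) Γ where
  toFun := TreeCell.proj
  map_bar t := by induction t using TreeCell.ind; rfl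
  map_τ t := by
    induction t using TreeCell.ind with | _ x v hv γ
    exact congrArg Subtype.val hv.symm

/-- The action of `π₁(Γ, G, p)` on the Bass–Serre tree: `g • (γ ι_e(G_e)) = (g γ) ι_e(G_e)`. -/
instance instMulActionTree : MulAction (PiOne G p) (tree G p).carrier where
  smul g := Quot.map (fun a => ⟨a.x, a.v, a.hv, g.comp a.γ⟩) (by
    rintro _ _ ⟨x, hc, hv, γ, h⟩
    dsimp only
    rw [← PathClass.comp_assoc]
    exact PreCell.Rel.mk x hc hv _ h)
  one_smul t := by
    induction t using TreeCell.ind with | _ x v hv γ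
    exact congrArg (TreeCell.mk x hv) (PathClass.of_one_comp γ)
  mul_smul g g' t := by
    induction t using TreeCell.ind with | _ x v hv γ
    exact congrArg (TreeCell.mk x hv) (PathClass.comp_assoc g g' γ)

variable {G p}

theorem vert_treeRoot {π : Morphism (GraphOfGroups.trivial (tree G p)) G}
    (h : π.graph = treeProj G p) : π.graph.vert (treeRoot G p) = p := by
  rw [h]; rfl

variable (p)

/-- `π : Γ̃ → (Γ, G)` is a covering projection. It is the projection on graphs, and every path
`η` in `Γ̃` from `p̃` to a vertex `τ t` is a lift of the path `π η` in `(Γ, G)`, in such a way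
that a cell `t` is the coset represented by `(π η) δ_t`. In particular (for `t` a vertex, where
`δ_t = 1`) the path `η` ends at the coset of `π η`, and for every vertex `ṽ` over `v` the
bijection from the star of `ṽ` to pairs of an edge `e` ending at `v` and a coset of `ι_e(G_e)` in
`G_v` is `ẽ ↦ (e, δ_ẽ ι_e(G_e))`. The projection depends on a choice (of coset
representatives, or of a fundamental domain containing `p̃`). -/
structure IsCoveringProjection (π : Morphism (GraphOfGroups.trivial (tree G p)) G) : Prop where
  graph : π.graph = treeProj G p
  lift : ∀ (t : (tree G p).carrier) {w : (tree G p).Vert} (hw : (tree G p).tip t = w)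
    (η : GPath (GraphOfGroups.trivial (tree G p)) (treeRoot G p) w),
    t = TreeCell.mk (π.graph.toFun t) (π.graph.tip_map hw)
      (((PathClass.mk (π.mapPath η)).copy (vert_treeRoot graph) rfl).comp
        (PathClass.of (π.δ t hw)))

end Tree

section Existence

variable {Γ : GerstenGraph.{u}} {G : GraphOfGroups.{u, v} Γ} {p : Γ.Vert}

theorem TreeCell.exact_vert {w : Γ.Vert} {γ γ' : PathClass G p w}
    (h : TreeCell.mk w.1 (Γ.tip_vert w) γ = TreeCell.mk w.1 (Γ.tip_vert w) γ') :
    ∃ g : G.grp w.cell, γ' = γ.comp (PathClass.of g) := by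
  have key : ∀ a b : PreCell G p, Relation.EqvGen (PreCell.Rel G p) a b →
      ∃ (hv : a.v = b.v) (g : G.grp b.v.cell), b.γ = (a.γ.copy rfl hv).comp (PathClass.of g) := by
    intro a b hab
    induction hab with
    | rel a b h =>
      obtain ⟨x, hc, hv, γ, h⟩ := h
      exact ⟨rfl, _, rfl⟩
    | refl a => exact ⟨rfl, 1, (PathClass.comp_of_one _).symm⟩
    | symm a b _ ih =>
      obtain ⟨ax, av, ahv, aγ⟩ := a
      obtain ⟨bx, bv, bhv, bγ⟩ := b
      obtain ⟨hv, g, e⟩ := ih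
      dsimp only at hv; subst hv
      refine ⟨rfl, g⁻¹, ?_⟩
      dsimp only [PathClass.copy] at e ⊢
      rw [e, PathClass.comp_assoc, PathClass.of_comp_of, mul_inv_cancel, PathClass.comp_of_one]
    | trans a b c _ _ ih ih' =>
      obtain ⟨ax, av, ahv, aγ⟩ := a
      obtain ⟨bx, bv, bhv, bγ⟩ := b
      obtain ⟨cx, cv, chv, cγ⟩ := c
      obtain ⟨hv, g, e⟩ := ih
      obtain ⟨hv', g', e'⟩ := ih'
      dsimp only at hv hv'; subst hv hv'
      refine ⟨rfl, g * g', ?_⟩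
      dsimp only [PathClass.copy] at e e' ⊢
      rw [e', e, PathClass.comp_assoc, PathClass.of_comp_of]
  obtain ⟨_, g, e⟩ := key _ _ (Quot.eqvGen_exact h)
  exact ⟨g, e⟩

theorem TreeCell.exists_rep (t : (tree G p).carrier) {w : (tree G p).Vert}
    (hw : (tree G p).tip t = w) :
    ∃ γ : PathClass G p ((treeProj G p).vert w),
      t = TreeCell.mk ((treeProj G p).toFun t) ((treeProj G p).tip_map hw) γ := by
  subst hw
  induction t using TreeCell.ind with | _ x v hv γ
  exact ⟨γ, rfl⟩

open Classical in
/-- Covering projections exist. -/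
theorem exists_isCoveringProjection : ∃ π, IsCoveringProjection (G := G) p π := by
  have h0 : ∀ (t : (tree G p).carrier) (w : (tree G p).Vert) (hw : (tree G p).tip t = w),
      ∃ γ : PathClass G p ((treeProj G p).vert w),
      t = TreeCell.mk ((treeProj G p).toFun t) ((treeProj G p).tip_map hw) γ ∧
      (w = treeRoot G p → t = (treeRoot G p).1 → HEq γ (PathClass.of (G := G) (a := p) 1)) := by
    intro t w hw
    by_cases h : w = treeRoot G p ∧ t = (treeRoot G p).1
    · obtain ⟨rfl, rfl⟩ := h
      exact ⟨PathClass.of (G := G) (a := p) 1, rfl, fun _ _ => HEq.rfl⟩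
    · obtain ⟨γ, hγ⟩ := TreeCell.exists_rep t hw
      exact ⟨γ, hγ, fun a b => (h ⟨a, b⟩).elim⟩
  choose c0 hc0 hroot using h0
  let o : (tree G p).Cell → (tree G p).carrier := Quot.out
  have ho : ∀ t, o ((tree G p).cell t) = t ∨ o ((tree G p).cell t) = (tree G p).bar t := by
    intro t
    have h : (tree G p).cell (o ((tree G p).cell t)) = (tree G p).cell t := Quot.out_eq _
    have := Quot.eqvGen_exact h
    have key : ∀ a b, Relation.EqvGen (fun x y => y = (tree G p).bar x) a b →
        a = b ∨ a = (tree G p).bar b := by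
      intro a b hab
      induction hab with
      | rel a b h => right; rw [h, (tree G p).bar_bar]
      | refl a => left; rfl
      | symm a b _ ih =>
        rcases ih with h | h
        · left; exact h.symm
        · right; rw [h, (tree G p).bar_bar]
      | trans a b c _ _ ih ih' =>
        rcases ih with rfl | rfl <;> rcases ih' with rfl | rfl <;> simp [(tree G p).bar_bar]
    exact key _ _ this
  let C : ∀ (t : (tree G p).carrier) (w : (tree G p).Vert) (hw : (tree G p).tip t = w),
      PathClass G p ((treeProj G p).vert w) := fun t w hw =>
    if t = o ((tree G p).cell t) then c0 t w hw
    else (c0 ((tree G p).bar t) _ rfl).comp (PathClass.edge ((treeProj G p).toFun t)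
      ((treeProj G p).tip_bar_map rfl) ((treeProj G p).tip_map hw))
  have hC1 : ∀ t w hw, t = TreeCell.mk ((treeProj G p).toFun t) ((treeProj G p).tip_map hw)
      (C t w hw) := by
    intro t w hw
    by_cases h : t = o ((tree G p).cell t)
    · simp only [C, if_pos h]; exact hc0 t w hw
    · simp only [C, if_neg h]
      have e := congrArg (tree G p).bar (hc0 ((tree G p).bar t) _ rfl)
      rw [(tree G p).bar_bar] at e
      refine e.trans ?_
      refine TreeCell.bar_mk ?_ _ _ _ _
      rw [(treeProj G p).map_bar, Γ.bar_bar]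
  have hCv : ∀ t w hw, (tree G p).bar t = t → C t w hw = c0 t w hw := by
    intro t w hw h
    have : t = o ((tree G p).cell t) := by rcases ho t with h' | h' <;> simp [h', h]
    simp only [C, if_pos this]
  have hCneg : ∀ t w hw, ¬ (t = o ((tree G p).cell t)) → ∀ w' (hw' : (tree G p).tip _ = w'),
      C t w hw = (c0 ((tree G p).bar t) w' hw').comp (PathClass.edge ((treeProj G p).toFun t)
      ((treeProj G p).tip_bar_map hw') ((treeProj G p).tip_map hw)) := by
    rintro t w hw h _ rfl
    simp only [C, if_neg h]
  have hC2 : ∀ t a b ha hb, C t b hb = (C ((tree G p).bar t) a ha).comp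
      (PathClass.edge ((treeProj G p).toFun t)
      ((treeProj G p).tip_bar_map ha) ((treeProj G p).tip_map hb)) := by
    intro t a b ha hb
    by_cases hv : (tree G p).bar t = t
    · have hab : a = b := by rw [← ha, ← hb, hv]
      subst hab
      rw [PathClass.edge_of_vertex, PathClass.comp_of_one]
      · congr 1; exact hv.symm
      · rw [← (treeProj G p).map_bar, hv]
    · by_cases h : t = o ((tree G p).cell t)
      · have h' : ¬ ((tree G p).bar t = o ((tree G p).cell ((tree G p).bar t))) := by
          rw [(tree G p).cell_bar, ← h]; exact hv
        have hb' : (tree G p).tip ((tree G p).bar ((tree G p).bar t)) = b := by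
          rw [(tree G p).bar_bar]; exact hb
        rw [hCneg _ _ ha h' b hb', PathClass.comp_assoc, PathClass.edge_comp_edge_bar,
          PathClass.comp_of_one]
        · simp only [C, if_pos h]
          congr 1
          exact ((tree G p).bar_bar t).symm
        · rw [(treeProj G p).map_bar, Γ.bar_bar]
      · have h' : (tree G p).bar t = o ((tree G p).cell ((tree G p).bar t)) := by
          rw [(tree G p).cell_bar]; rcases ho t with h1 | h1
          · exact (h h1.symm).elim
          · exact h1.symm
        rw [hCneg _ _ hb h a ha]
        simp only [C, if_pos h']
  have hδ : ∀ (t : (tree G p).carrier) (w : (tree G p).Vert) (hw : (tree G p).tip t = w),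
      ∃ g : G.grp ((treeProj G p).vert w).cell,
        C t w hw = (C w.1 w ((tree G p).tip_vert w)).comp (PathClass.of g) ∧
        (t = w.1 → g = 1) := by
    intro t w hw
    by_cases h : t = w.1
    · subst h; exact ⟨1, (PathClass.comp_of_one _).symm, fun _ => rfl⟩
    · have e1 : w.1 = TreeCell.mk _ (Γ.tip_vert _) (C t w hw) := by
        have := congrArg (tree G p).τ (hC1 t w hw)
        refine Eq.trans ?_ this
        rw [← hw]; rfl
      have e2 : w.1 = TreeCell.mk _ (Γ.tip_vert _) (C w.1 w ((tree G p).tip_vert w)) := hC1 _ _ _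
      obtain ⟨g, hg⟩ := TreeCell.exact_vert (e2.symm.trans e1)
      exact ⟨g, hg, fun h' => (h h').elim⟩
  choose d hd hd1 using hδ
  let π : Morphism (GraphOfGroups.trivial (tree G p)) G :=
    { graph := treeProj G p
      hom := fun _ => 1
      δ := fun t w hw => d t w hw
      δ_vert := fun w => hd1 _ _ _ rfl
      pseudonatural := by intros; simp; rfl }
  have hB : ∀ (a b : (tree G p).Vert) (η : GPath (GraphOfGroups.trivial (tree G p)) a b),
      (C a.1 a ((tree G p).tip_vert a)).comp (PathClass.mk (π.mapPath η)) =
      C b.1 b ((tree G p).tip_vert b) := by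
    intro a b η
    induction η with
    | base g => exact PathClass.comp_of_one _
    | @cons a b c g t ha hb γ ih =>
      rw [Morphism.mk_mapPath_cons]
      have : π.vhom a g = 1 := rfl
      rw [this, PathClass.of_one_comp, ← ih, ← PathClass.comp_assoc, ← PathClass.comp_assoc]
      change (((C a.1 a _).comp (PathClass.of (d _ a ha))).comp _).comp _ = _
      have k := (hd _ _ ha).symm
      rw [k, ← PathClass.comp_assoc]
      congr 1
      have k2 := (hC2 t a b ha hb).symm
      refine (congrArg (PathClass.comp · (PathClass.of (d t b hb)⁻¹)) k2).trans ?_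
      rw [hd t b hb, PathClass.comp_assoc, PathClass.of_comp_of, mul_inv_cancel,
        PathClass.comp_of_one]
  refine ⟨π, rfl, ?_⟩
  intro t w hw η
  have h1 : PathClass.mk (π.mapPath η) = C w.1 w ((tree G p).tip_vert w) := by
    rw [← hB _ _ η, hCv _ _ _ (treeRoot G p).2]
    have := eq_of_heq (hroot _ _ ((tree G p).tip_vert (treeRoot G p)) rfl rfl)
    rw [this]
    exact (PathClass.of_one_comp _).symm
  have h2 := hC1 t w hw
  rw [hd] at h2
  rw [h1]
  exact h2

end Existence

section Diagram

variable {Λ : GerstenGraph.{u₁}} {Γ : GerstenGraph.{u₂}}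
  {L : GraphOfGroups.{u₁, v₁} Λ} {G : GraphOfGroups.{u₂, v₂} Γ} {p : Λ.Vert} {q : Γ.Vert}

theorem vert_eq_of_square {f : Morphism L G} {ft : GraphHom (tree L p) (tree G q)}
    {πΛ : Morphism (GraphOfGroups.trivial (tree L p)) L}
    {πΓ : Morphism (GraphOfGroups.trivial (tree G q)) G}
    (h : ∀ t, πΓ.graph.toFun (ft.toFun t) = f.graph.toFun (πΛ.graph.toFun t))
    (w : (tree L p).Vert) : πΓ.graph.vert (ft.vert w) = f.graph.vert (πΛ.graph.vert w) :=
  Subtype.ext (h w.1)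

/-- `ft : Λ̃ → Γ̃` preserves the distinguished lifts of the basepoints, and the diagram with the
covering projections `πΛ`, `πΓ` and the morphism `f` commutes: as a diagram of
morphisms of graphs, and on paths, in the sense that for every path `η` in `Λ̃` from `p̃` to a
vertex `w`, the paths `πΓ (ft η)` and `f (πΛ η)` in `(Γ, G)` are homotopic rel endpoints up to
right multiplication by an element of the vertex group at their terminal vertex. -/
structure IsLift (πΛ : Morphism (GraphOfGroups.trivial (tree L p)) L)
    (πΓ : Morphism (GraphOfGroups.trivial (tree G q)) G) (f : Morphism L G)
    (ft : GraphHom (tree L p) (tree G q)) : Prop where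
  root : ft.vert (treeRoot L p) = treeRoot G q
  square : ∀ t, πΓ.graph.toFun (ft.toFun t) = f.graph.toFun (πΛ.graph.toFun t)
  path : ∀ (w : (tree L p).Vert)
    (η : GPath (GraphOfGroups.trivial (tree L p)) (treeRoot L p) w),
    ∃ g : G.grp (f.graph.vert (πΛ.graph.vert w)).cell,
      Homotopic
        ((πΓ.mapPath (ft.toMorphism.mapPath η)).copy (vert_eq_of_square square _)
          (vert_eq_of_square square _))
        ((f.mapPath (πΛ.mapPath η)).append (GPath.base g))

/-- `ft` is equivariant with respect to `φ : π₁(Λ, L, p) → π₁(Γ, G, q)`. -/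
def IsEquivariant (φ : PiOne L p →* PiOne G q) (ft : GraphHom (tree L p) (tree G q)) : Prop :=
  ∀ (g : PiOne L p) (t : (tree L p).carrier), ft.toFun (g • t) = φ g • ft.toFun t

end Diagram

end BassSerre

/-! Part 1. A morphism acts on homotopy classes of paths, and the lift must send the coset of `γ`
over `x` to the coset of `f(γ) δ_x` over `f(x)`. Pseudonaturality says exactly that this does not
depend on the representative, and equivariance is functoriality of `f` on paths. For uniqueness, the
tree is connected, so the path condition fixes the image of every vertex. An edge of the tree is
determined by its projection and its two endpoints (`TreeCell.ext_of_endpoints`), so edges are fixed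
as well.

Part 2. The group `π₁(Λ, L, p)` is transitive on the fibres of `Λ̃ → Λ`, so an equivariant `ft`
descends to a graph morphism `g`. Choosing paths `γ_v` in `Λ` and representatives `β_v` of the
images of the vertices `γ_v L_v` extends `φ` to a functor `T` of path groupoids over `g`
(`PathLift`). Comparing cosets over `x` with their images gives elements `δ_x`; comparing two
representatives of one coset shows that `T` carries `ι_x(L_c)` into `δ_x ι_{g x}(G_{g c}) δ_x⁻¹`,
which yields the edge homomorphisms. The resulting morphism agrees with `T` on vertex group elements
and on edges, hence on all paths.

Both parts rest on facts usually read off from normal forms: vertex groups embed in the path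
groupoid (`PathClass.of_injective`), and `k e = e g` forces `g` to lie in the image of the edge
group (`exists_ι_eq_of_comp_edge`). Here they come from permutation actions. The sets `G_v × Y`,
with `Y` infinite and large enough, are isomorphic to `G_e × Y` as right `G_e`-sets, so the path
groupoid acts on them with each vertex group acting freely. Modifying one of these isomorphisms
detects elements outside an edge group. -/

namespace BassSerre

/-! ### Free permutation actions of the path groupoid -/

/-- If `H` embeds in `K` and `Y` is infinite of cardinality at least that of `K`, then `K × Y` and
`H × Y` are isomorphic as right `H`-sets. -/
theorem exists_equivariant_equiv {H K : Type v} {Y : Type (max u v)} [Group H] [Group K]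
    [Infinite Y] (ι : H →* K) (hι : Function.Injective ι) (hK : Nonempty (K ↪ Y)) :
    ∃ α : K × Y ≃ H × Y, ∀ h k y, α (k * ι h, y) = ((α (k, y)).1 * h, (α (k, y)).2) := by
  obtain ⟨j⟩ := hK
  -- `K` is a free right `H`-set with orbit set `K ⧸ ι.range`; the orbits can be absorbed into `Y`
  -- because `Y` is infinite and at least as large as the set of orbits.
  have hq : Nonempty ((K ⧸ ι.range) × Y ≃ Y) := by
    rw [← Cardinal.eq, Cardinal.mk_prod]
    have hle : Cardinal.lift.{max u v} (Cardinal.mk (K ⧸ ι.range)) ≤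
        Cardinal.lift.{v} (Cardinal.mk Y) :=
      Cardinal.lift_mk_le'.2 ⟨⟨fun s => j (Quotient.out s), fun s t h =>
        Quotient.out_injective (j.injective h)⟩⟩
    rw [Cardinal.mul_eq_right (by simp) hle (by simp)]
    exact Cardinal.lift_id'.{v, max u v} _
  obtain ⟨θ⟩ := hq
  let ε : ι.range ≃ H := (MonoidHom.ofInjective hι).symm.toEquiv
  let s : (K ⧸ ι.range) → K := Quotient.out
  have hs : ∀ k : K, (s k)⁻¹ * k ∈ ι.range := fun k =>
    QuotientGroup.leftRel_apply.1 (Quotient.exact (Quotient.out_eq (k : K ⧸ ι.range)))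
  have hmk : ∀ (k : K) h, ((k * ι h : K) : K ⧸ ι.range) = k := fun k h =>
    QuotientGroup.mk_mul_of_mem k ⟨h, rfl⟩
  -- Each `k` is uniquely `s k * ι h` with `s k` the chosen representative of its coset; `h` becomes
  -- the first coordinate and the coset is absorbed by `θ`.
  let α : K × Y ≃ H × Y :=
    { toFun := fun z => (ε ⟨_, hs z.1⟩, θ ((z.1 : K ⧸ ι.range), z.2))
      invFun := fun z => (s (θ.symm z.2).1 * ι z.1, (θ.symm z.2).2)
      left_inv := fun ⟨k, y⟩ => by
        have : ι (ε ⟨_, hs k⟩) = (s k)⁻¹ * k :=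
          congrArg Subtype.val ((MonoidHom.ofInjective hι).apply_symm_apply ⟨_, hs k⟩)
        simp [this]
      right_inv := fun ⟨h, y⟩ => by
        obtain ⟨⟨k, y⟩, rfl⟩ := θ.surjective y
        have e : ((s k * ι h : K) : K ⧸ ι.range) = k := by rw [hmk]; exact Quotient.out_eq k
        simp only [Equiv.symm_apply_apply, e]
        refine Prod.ext ?_ rfl
        change (MonoidHom.ofInjective hι).symm _ = h
        rw [MulEquiv.symm_apply_eq]
        refine Subtype.ext ?_
        change _ = ι h
        simp }
  refine ⟨α, fun h k y => ?_⟩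
  refine Prod.ext ?_ ?_
  · change (MonoidHom.ofInjective hι).symm _ = (MonoidHom.ofInjective hι).symm _ * h
    rw [MulEquiv.symm_apply_eq, map_mul, MulEquiv.apply_symm_apply]
    refine Subtype.ext ?_
    change (s _)⁻¹ * (k * ι h) = (s _)⁻¹ * k * ι h
    rw [hmk, mul_assoc]
  · change θ _ = θ _
    simp only [hmk]

/-- A free action of the path groupoid of `(Γ, G)`: the vertex group `G_v` acts on `G_v × Y` by
right multiplication, and an edge `x` acts by `(α (bar x))⁻¹ ∘ α x`. -/
structure FreeAction {Γ : GerstenGraph.{u}} (G : GraphOfGroups.{u, v} Γ) (Y : Type*) where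
  α : ∀ (x : Γ.carrier) {c : Γ.Cell} {v : Γ.Vert}, Γ.cell x = c → Γ.tip x = v →
    (G.grp v.cell × Y ≃ G.grp c × Y)
  equivariant : ∀ (x : Γ.carrier) {c : Γ.Cell} {v : Γ.Vert} (hc : Γ.cell x = c)
    (hv : Γ.tip x = v) (h : G.grp c) (g : G.grp v.cell) (y : Y),
    α x hc hv (g * G.ι x hc hv h, y) = ((α x hc hv (g, y)).1 * h, (α x hc hv (g, y)).2)

namespace GraphOfGroups

variable {Γ : GerstenGraph.{u}} (G : GraphOfGroups.{u, v} Γ)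

theorem ι_congr {x y : Γ.carrier} (e : x = y) {c : Γ.Cell} {v : Γ.Vert} (hc : Γ.cell x = c)
    (hv : Γ.tip x = v) (hc' : Γ.cell y = c) (hv' : Γ.tip y = v) (k : G.grp c) :
    G.ι x hc hv k = G.ι y hc' hv' k := by
  subst e; rfl

theorem ι_vert_apply (w : Γ.Vert) (hc : Γ.cell w.1 = w.cell) (hv : Γ.tip w.1 = w)
    (k : G.grp w.cell) : G.ι w.1 hc hv k = k :=
  DFunLike.congr_fun (G.ι_vert w) k

/-- The index set of the free action of the path groupoid. -/
def FreeIndex : Type (max u v) := List (Σ a : Γ.Vert, G.grp a.cell)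

/-- One index set has to serve all cells. Lists over the disjoint union of the vertex groups form an
infinite set, and every vertex group embeds in it by one-letter lists. -/
theorem nonempty_freeAction [Nonempty Γ.Vert] : Nonempty (FreeAction G G.FreeIndex) := by
  have : Nonempty (Σ a : Γ.Vert, G.grp a.cell) := ⟨⟨Classical.arbitrary _, 1⟩⟩
  have : Infinite G.FreeIndex := inferInstanceAs (Infinite (List _))
  have h := fun (x : Γ.carrier) (c : Γ.Cell) (v : Γ.Vert) (hc : Γ.cell x = c)
      (hv : Γ.tip x = v) =>
    exists_equivariant_equiv.{u, v} (Y := G.FreeIndex) (G.ι x hc hv) (G.ι_injective x hc hv)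
      ⟨⟨fun g => [⟨v, g⟩], fun g g' e => by
        simpa using (List.cons.inj (show ([⟨v, g⟩] : List (Σ a : Γ.Vert, G.grp a.cell)) =
          [⟨v, g'⟩] from e)).1⟩⟩
  choose α hα using h
  exact ⟨⟨fun x c v => α x c v, hα⟩⟩

end GraphOfGroups

namespace FreeAction

variable {Γ : GerstenGraph.{u}} {G : GraphOfGroups.{u, v} Γ} {Y : Type*} (A : FreeAction G Y)

theorem α_congr {x y : Γ.carrier} (e : x = y) {c : Γ.Cell} {v : Γ.Vert} (hc : Γ.cell x = c)
    (hv : Γ.tip x = v) (hc' : Γ.cell y = c) (hv' : Γ.tip y = v) : A.α x hc hv = A.α y hc' hv' := by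
  subst e; rfl

/-- The action of an edge. -/
def edgeEquiv {a b : Γ.Vert} (x : Γ.carrier) (ha : Γ.tip (Γ.bar x) = a) (hb : Γ.tip x = b) :
    G.grp b.cell × Y ≃ G.grp a.cell × Y :=
  (A.α x rfl hb).trans (A.α (Γ.bar x) (Γ.cell_bar x) ha).symm

theorem edgeEquiv_bar {a b : Γ.Vert} (x : Γ.carrier) (ha : Γ.tip (Γ.bar x) = a)
    (hb : Γ.tip x = b) (hb' : Γ.tip (Γ.bar (Γ.bar x)) = b) (z : G.grp b.cell × Y) :
    A.edgeEquiv (Γ.bar x) hb' ha (A.edgeEquiv x ha hb z) = z := by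
  -- The cells of `x` and `bar x` agree only up to a propositional equality, so the cancellation is
  -- proved for a common `c`, and `transport` moves between the two choices.
  have key : ∀ {c : Γ.Cell} (hc : Γ.cell x = c) (hc' : Γ.cell (Γ.bar x) = c)
      (hc'' : Γ.cell (Γ.bar (Γ.bar x)) = c),
      (A.α (Γ.bar (Γ.bar x)) hc'' hb').symm (A.α (Γ.bar x) hc' ha
        ((A.α (Γ.bar x) hc' ha).symm (A.α x hc hb z))) = z := by
    intro c hc hc' hc''
    rw [Equiv.apply_symm_apply, A.α_congr (Γ.bar_bar x) hc'' hb' hc hb, Equiv.symm_apply_apply]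
  have transport : ∀ {c c' : Γ.Cell} (e : c = c') (hc : Γ.cell x = c)
      (hc' : Γ.cell (Γ.bar x) = c'),
      (A.α (Γ.bar x) hc' ha).symm (A.α x (hc.trans e) hb z) =
        (A.α (Γ.bar x) (hc'.trans e.symm) ha).symm (A.α x hc hb z) := by
    rintro c _ rfl _ _; rfl
  have h := key (Γ.cell_bar x).symm rfl (Γ.cell_bar (Γ.bar x))
  rwa [transport (Γ.cell_bar x).symm rfl rfl] at h

/-- The action of a vertex group element. -/
def act {a : Γ.Vert} (g : G.grp a.cell) (z : G.grp a.cell × Y) : G.grp a.cell × Y :=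
  (z.1 * g⁻¹, z.2)

theorem act_mul {a : Γ.Vert} (g h : G.grp a.cell) (z : G.grp a.cell × Y) :
    act (g * h) z = act g (act h z) := by
  simp [act, mul_assoc]

theorem act_one {a : Γ.Vert} (z : G.grp a.cell × Y) : act 1 z = z := by
  simp [act]

/-- The action of a path. -/
def path {a b : Γ.Vert} : GPath G a b → G.grp b.cell × Y → G.grp a.cell × Y
  | .base g => act g
  | .cons g x ha hb γ => fun z => act g (A.edgeEquiv x ha hb (path γ z))

theorem path_lmul {a b : Γ.Vert} (g : G.grp a.cell) (γ : GPath G a b) (z : G.grp b.cell × Y) :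
    A.path (GPath.lmul g γ) z = act g (A.path γ z) := by
  cases γ <;> simp [GPath.lmul, path, act_mul]

theorem path_append {a b c : Γ.Vert} (γ : GPath G a b) (η : GPath G b c)
    (z : G.grp c.cell × Y) : A.path (γ.append η) z = A.path γ (A.path η z) := by
  induction γ with
  | base g => simp [GPath.append, path, path_lmul]
  | cons g x ha hb γ ih => simp [GPath.append, path, ih]

theorem path_reverse {a b : Γ.Vert} (γ : GPath G a b) (z : G.grp b.cell × Y) :
    A.path γ.reverse (A.path γ z) = z := by
  induction γ with
  | base g => simp [GPath.reverse, path, act]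
  | cons g x ha hb γ ih =>
    simp only [GPath.reverse, path_append, path]
    rw [← act_mul, inv_mul_cancel, act_one, act_one, edgeEquiv_bar, ih]

/-- `edgeEquiv` passes through `G_c × Y`, and both bijections used are equivariant for right
multiplication by the edge group; this is the slide relation. -/
theorem edgeEquiv_act {a b : Γ.Vert} (x : Γ.carrier) {c : Γ.Cell} (hc : Γ.cell x = c)
    (ha : Γ.tip (Γ.bar x) = a) (hb : Γ.tip x = b) (h : G.grp c) (z : G.grp b.cell × Y) :
    A.edgeEquiv x ha hb (act (G.ι x hc hb h) z) =
      act (G.ι (Γ.bar x) ((Γ.cell_bar x).trans hc) ha h) (A.edgeEquiv x ha hb z) := by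
  subst hc
  obtain ⟨g, y⟩ := z
  obtain ⟨⟨g', y'⟩, hz⟩ := (A.α (Γ.bar x) (Γ.cell_bar x) ha).surjective (A.α x rfl hb (g, y))
  simp only [edgeEquiv, Equiv.trans_apply, ← hz, Equiv.symm_apply_apply]
  rw [Equiv.symm_apply_eq]
  simp only [act, ← map_inv]
  rw [A.equivariant, A.equivariant, hz]

/-- Every free action is thereby an invariant of homotopy classes: paths that move some point
differently are not homotopic. -/
theorem path_homotopic {a b : Γ.Vert} {γ η : GPath G a b} (h : Homotopic γ η) :
    A.path γ = A.path η := by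
  induction h with
  | refl γ => rfl
  | symm _ ih => exact ih.symm
  | trans _ _ ih ih' => exact ih.trans ih'
  | append _ _ ih ih' => funext z; rw [path_append, path_append, ih, ih']
  | cancel σ =>
    funext z
    have := A.path_reverse σ.reverse z
    rw [GPath.reverse_reverse] at this
    rw [path_append, this, path, act_one]
  | slide x hc ha hb h => funext z; simp [path, act_one, edgeEquiv_act]
  | const w =>
    funext z
    simp only [GPath.edge, path, act_one, edgeEquiv, Equiv.trans_apply]
    rw [Equiv.symm_apply_eq, A.α_congr w.2]

open Classical in
/-- The permutation exchanging `y₀` and `y₁` over a subgroup. -/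
noncomputable def swapOver {K : Type*} [Group K] (S : Subgroup K) (y₀ y₁ : Y) : K × Y ≃ K × Y :=
  Function.Involutive.toPerm (fun z => if z.1 ∈ S then (z.1, Equiv.swap y₀ y₁ z.2) else z)
    (fun z => by by_cases hz : z.1 ∈ S <;> simp [hz])

theorem swapOver_of_mem {K : Type*} [Group K] {S : Subgroup K} (y₀ : Y) {k : K} (hk : k ∈ S)
    (y₁ : Y) : swapOver S y₀ y₁ (k, y₀) = (k, y₁) := by
  classical
  refine (if_pos hk).trans ?_
  rw [Equiv.swap_apply_left]

theorem swapOver_of_not_mem {K : Type*} [Group K] {S : Subgroup K} (y₀ y₁ y : Y) {k : K}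
    (hk : k ∉ S) : swapOver S y₀ y₁ (k, y) = (k, y) :=
  if_neg hk

/-- Right multiplication by an element of `S` preserves both `S` and its complement, so the swap
commutes with it. This is what keeps `twist` equivariant. -/
theorem swapOver_mul {K : Type*} [Group K] {S : Subgroup K} (y₀ y₁ y : Y) (k : K) {h : K}
    (hh : h ∈ S) : swapOver S y₀ y₁ (k * h, y) =
      ((swapOver S y₀ y₁ (k, y)).1 * h, (swapOver S y₀ y₁ (k, y)).2) := by
  classical
  have : k * h ∈ S ↔ k ∈ S := Subgroup.mul_mem_cancel_right _ hh
  change (if _ then _ else _) = ((if _ then _ else _ : K × Y).1 * h, (if _ then _ else _ : K × Y).2)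
  simp only [this]
  split_ifs <;> rfl

open Classical in
/-- The action obtained by precomposing `α x₀` with the permutation that exchanges `y₀` and `y₁`
over the image of the edge group. -/
noncomputable def twist (x₀ : Γ.carrier) (y₀ y₁ : Y) : FreeAction G Y where
  α x {_ _} hc hv := if x = x₀ then
      (swapOver (G.ι x hc hv).range y₀ y₁).trans (A.α x hc hv)
    else A.α x hc hv
  equivariant x c v hc hv h g y := by
    by_cases hx : x = x₀
    · have hh : G.ι x hc hv h ∈ (G.ι x hc hv).range := ⟨h, rfl⟩
      simp only [if_pos hx, Equiv.trans_apply, swapOver_mul y₀ y₁ y g hh]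
      exact A.equivariant x hc hv h _ _
    · simp only [if_neg hx]
      exact A.equivariant x hc hv h _ _

end FreeAction

/-! ### Vertex groups embed; Britton's lemma -/

section Embedding

variable {Γ : GerstenGraph.{u}} {G : GraphOfGroups.{u, v} Γ}

/-- The vertex groups embed in the path groupoid. -/
theorem PathClass.of_injective {a : Γ.Vert} :
    Function.Injective (PathClass.of : G.grp a.cell → PathClass G a a) := by
  intro g h e
  have : Nonempty Γ.Vert := ⟨a⟩
  obtain ⟨A⟩ := G.nonempty_freeAction
  -- The point `(1, [])` is moved by `g` to `(g⁻¹, [])`, so its image determines `g`.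
  have := congrFun (A.path_homotopic (PathClass.exact e)) (1, ([] : List _))
  have h2 := congrArg Prod.fst this
  simpa [FreeAction.path, FreeAction.act] using h2

/-- Britton's lemma for a single backtracking. -/
theorem exists_ι_eq_of_comp_edge {a b : Γ.Vert} (x : Γ.carrier) {c : Γ.Cell}
    (hc : Γ.cell x = c) (ha : Γ.tip (Γ.bar x) = a) (hb : Γ.tip x = b) {k : G.grp a.cell}
    {g : G.grp b.cell}
    (e : (PathClass.of k).comp (PathClass.edge x ha hb) =
      (PathClass.edge x ha hb : PathClass G a b).comp (PathClass.of g)) :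
    ∃ h, G.ι x hc hb h = g := by
  classical
  by_cases hx : Γ.bar x = x
  · obtain ⟨w, rfl⟩ : ∃ w : Γ.Vert, w.1 = x := ⟨⟨x, hx⟩, rfl⟩
    obtain rfl : w = b := (Γ.tip_vert w).symm.trans hb
    subst hc
    exact ⟨g, G.ι_vert_apply _ _ _ _⟩
  · by_contra hg
    have : Nonempty Γ.Vert := ⟨a⟩
    obtain ⟨A⟩ := G.nonempty_freeAction
    -- The assumed relation holds in every free action. It is compared in `A` and in its twist at
    -- `x`, whose edge map is that of `A` preceded by the swap over the edge group; `bar x ≠ x`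
    -- ensures that only one of the two factors of the edge map changes.
    have key : ∀ (B : FreeAction G G.FreeIndex) z,
        FreeAction.act k (B.edgeEquiv x ha hb z) = B.edgeEquiv x ha hb (FreeAction.act g z) := by
      intro B z
      have := congrFun (B.path_homotopic (PathClass.exact e)) z
      simpa [GPath.edge, B.path_append, FreeAction.path, FreeAction.act_one] using this
    let y₀ : G.FreeIndex := ([] : List _)
    let y₁ : G.FreeIndex := ([⟨a, 1⟩] : List _)
    have hy : y₀ ≠ y₁ := fun h => List.cons_ne_nil _ _ h.symm
    have hE : ∀ z, (A.twist x y₀ y₁).edgeEquiv x ha hb z =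
        A.edgeEquiv x ha hb (FreeAction.swapOver (G.ι x rfl hb).range y₀ y₁ z) := by
      intro z
      simp [FreeAction.edgeEquiv, FreeAction.twist, hx]
    have h1 := key (A.twist x y₀ y₁) (1, y₀)
    rw [hE, key, hE] at h1
    -- Hence the swap commutes with `g` at `(1, y₀)`. But it moves `(1, y₀)` and fixes `(g⁻¹, y₀)`,
    -- as `g⁻¹` lies outside the edge group.
    have h2 := (A.edgeEquiv x ha hb).injective h1
    subst hc
    have hg' : 1 * g⁻¹ ∉ (G.ι x rfl hb).range := fun h =>
      hg ((inv_mem_iff (x := g)).1 (by rwa [one_mul] at h))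
    rw [FreeAction.swapOver_of_mem _ (one_mem _), FreeAction.act, FreeAction.act,
      FreeAction.swapOver_of_not_mem _ _ _ hg'] at h2
    exact hy (congrArg Prod.snd h2).symm

end Embedding

/-! ### Cancellation and transport of endpoints for path classes -/

section Copy

variable {Γ : GerstenGraph.{u}} {G : GraphOfGroups.{u, v} Γ}

theorem PathClass.mk_copy {a b a' b' : Γ.Vert} (γ : GPath G a b) (ha : a = a') (hb : b = b') :
    mk (γ.copy ha hb) = (mk γ).copy ha hb := by
  subst ha hb; rfl

theorem PathClass.comp_copy {a b c a' c' : Γ.Vert} (γ : PathClass G a b) (η : PathClass G b c)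
    (ha : a = a') (hc : c = c') :
    (γ.comp η).copy ha hc = (γ.copy ha rfl).comp (η.copy rfl hc) := by
  subst ha hc; rfl

theorem PathClass.copy_congr_left {a b a' b' : Γ.Vert} {γ η : PathClass G a b} {ha : a = a'}
    {hb : b = b'} : γ.copy ha hb = η.copy ha hb ↔ γ = η := by
  subst ha hb; rfl

theorem PathClass.copy_copy {a b a' b' a'' b'' : Γ.Vert} (γ : PathClass G a b) (ha : a = a')
    (hb : b = b') (ha' : a' = a'') (hb' : b' = b'') :
    (γ.copy ha hb).copy ha' hb' = γ.copy (ha.trans ha') (hb.trans hb') := by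
  subst ha hb ha' hb'; rfl

theorem PathClass.comp_left_cancel {a b c : Γ.Vert} (γ : PathClass G a b) {η θ : PathClass G b c}
    (h : γ.comp η = γ.comp θ) : η = θ := by
  rw [← of_one_comp η, ← inv_comp γ, comp_assoc, h, ← comp_assoc, inv_comp, of_one_comp]

theorem PathClass.comp_right_cancel {a b c : Γ.Vert} (γ : PathClass G b c) {η θ : PathClass G a b}
    (h : η.comp γ = θ.comp γ) : η = θ := by
  rw [← comp_of_one η, ← comp_inv γ, ← comp_assoc, h, comp_assoc, comp_inv, comp_of_one]

theorem PathClass.inv_comp_comp {a b c : Γ.Vert} (γ : PathClass G a b) (η : PathClass G b c) :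
    γ.inv.comp (γ.comp η) = η := by
  rw [← comp_assoc, inv_comp, of_one_comp]

theorem PathClass.comp_inv_comp {a b c : Γ.Vert} (γ : PathClass G a b) (η : PathClass G a c) :
    γ.comp (γ.inv.comp η) = η := by
  rw [← comp_assoc, comp_inv, of_one_comp]

end Copy

/-! ### Cosets, connectedness and edges of the Bass–Serre tree -/

section Tree

variable {Γ : GerstenGraph.{u}} {G : GraphOfGroups.{u, v} Γ} {p : Γ.Vert}

/-- The image of `ι` is a subgroup, so the relation generating `TreeCell` is already an equivalence
relation. The induction runs over arbitrary `PreCell`s and therefore carries equalities of `x` and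
`v` along. -/
theorem TreeCell.exact {x : Γ.carrier} {c : Γ.Cell} {v : Γ.Vert} (hc : Γ.cell x = c)
    (hv : Γ.tip x = v) {γ γ' : PathClass G p v} (h : TreeCell.mk x hv γ = TreeCell.mk x hv γ') :
    ∃ k : G.grp c, γ' = γ.comp (PathClass.of (G.ι x hc hv k)) := by
  have key : ∀ a b : PreCell G p, Relation.EqvGen (PreCell.Rel G p) a b →
      ∃ (_ : a.x = b.x) (hv : a.v = b.v) (k : G.grp (Γ.cell b.x)),
        b.γ = (a.γ.copy rfl hv).comp (PathClass.of (G.ι b.x rfl b.hv k)) := by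
    intro a b hab
    induction hab with
    | rel a b h =>
      obtain ⟨x, hc, hv, γ, h⟩ := h
      subst hc
      exact ⟨rfl, rfl, _, rfl⟩
    | refl a =>
      exact ⟨rfl, rfl, 1, by rw [map_one]; exact (PathClass.comp_of_one _).symm⟩
    | symm a b _ ih =>
      obtain ⟨ax, av, ahv, aγ⟩ := a
      obtain ⟨bx, bv, bhv, bγ⟩ := b
      obtain ⟨hx, hv, g, e⟩ := ih
      dsimp only at hx hv; subst hx hv
      refine ⟨rfl, rfl, g⁻¹, ?_⟩
      dsimp only [PathClass.copy] at e ⊢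
      rw [e, PathClass.comp_assoc, PathClass.of_comp_of, ← map_mul, mul_inv_cancel, map_one,
        PathClass.comp_of_one]
    | trans a b c _ _ ih ih' =>
      obtain ⟨ax, av, ahv, aγ⟩ := a
      obtain ⟨bx, bv, bhv, bγ⟩ := b
      obtain ⟨cx, cv, chv, cγ⟩ := c
      obtain ⟨hx, hv, g, e⟩ := ih
      obtain ⟨hx', hv', g', e'⟩ := ih'
      dsimp only at hx hv hx' hv'; subst hx hv hx' hv'
      refine ⟨rfl, rfl, g * g', ?_⟩
      dsimp only [PathClass.copy] at e e' ⊢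
      rw [e', e, PathClass.comp_assoc, PathClass.of_comp_of, ← map_mul]
  subst hc
  obtain ⟨_, _, k, e⟩ := key _ _ (Quot.eqvGen_exact h)
  exact ⟨k, e⟩

theorem TreeCell.exists_eq_mk (t : (tree G p).carrier) {x : Γ.carrier} {v : Γ.Vert}
    (hx : (treeProj G p).toFun t = x) (hv : Γ.tip x = v) :
    ∃ γ : PathClass G p v, t = TreeCell.mk x hv γ := by
  subst hx hv
  induction t using TreeCell.ind with | _ x v hv γ
  subst hv
  exact ⟨γ, rfl⟩

theorem TreeCell.mk_comp_of {w : Γ.Vert} (γ : PathClass G p w) (g : G.grp w.cell) :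
    TreeCell.mk w.1 (Γ.tip_vert w) (γ.comp (PathClass.of g)) =
      TreeCell.mk w.1 (Γ.tip_vert w) γ := by
  exact (congrArg (fun k => TreeCell.mk w.1 (Γ.tip_vert w) (γ.comp (PathClass.of k)))
    (G.ι_vert_apply w rfl (Γ.tip_vert w) g)).symm.trans
    (TreeCell.sound (c := w.cell) w.1 rfl (Γ.tip_vert w) γ g)

theorem TreeCell.smul_mk (g : PiOne G p) {x : Γ.carrier} {v : Γ.Vert} (hv : Γ.tip x = v)
    (γ : PathClass G p v) {t : (tree G p).carrier} (ht : t = TreeCell.mk x hv γ) :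
    g • t = TreeCell.mk x hv (g.comp γ) := by
  subst ht; rfl

/-- The vertex `γ G_v` of the tree. -/
def treeVert {w : Γ.Vert} (γ : PathClass G p w) : (tree G p).Vert :=
  (tree G p).tip (TreeCell.mk w.1 (Γ.tip_vert w) γ)

theorem treeVert_val {w : Γ.Vert} (γ : PathClass G p w) :
    (treeVert γ).1 = TreeCell.mk w.1 (Γ.tip_vert w) γ := rfl

theorem treeVert_comp_of {w : Γ.Vert} (γ : PathClass G p w) (g : G.grp w.cell) :
    treeVert (γ.comp (PathClass.of g)) = treeVert γ :=
  Subtype.ext (TreeCell.mk_comp_of γ g)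

theorem exists_of_treeVert_eq {w : Γ.Vert} {γ γ' : PathClass G p w}
    (h : treeVert γ = treeVert γ') : ∃ g : G.grp w.cell, γ' = γ.comp (PathClass.of g) :=
  TreeCell.exact_vert (congrArg Subtype.val h)

theorem exists_eq_treeVert (w : (tree G p).Vert) :
    ∃ (v : Γ.Vert) (γ : PathClass G p v), w = treeVert γ := by
  obtain ⟨γ, h⟩ := TreeCell.exists_eq_mk w.1 (x := ((treeProj G p).vert w).1) rfl (Γ.tip_vert _)
  exact ⟨_, γ, Subtype.ext h⟩

theorem tip_mk {x : Γ.carrier} {v : Γ.Vert} (hv : Γ.tip x = v) (γ : PathClass G p v) :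
    (tree G p).tip (TreeCell.mk x hv γ) = treeVert γ := rfl

theorem bar_mk_comp_edge {x : Γ.carrier} {v w : Γ.Vert} (hw : Γ.tip (Γ.bar x) = w)
    (hv : Γ.tip x = v) (γ : PathClass G p w) :
    (tree G p).bar (TreeCell.mk x hv (γ.comp (PathClass.edge x hw hv))) =
      TreeCell.mk (Γ.bar x) hw γ := by
  have hv' : Γ.tip (Γ.bar (Γ.bar x)) = v := (congrArg Γ.tip (Γ.bar_bar x)).trans hv
  refine (TreeCell.bar_mk rfl hv hv' hw _).trans ?_
  rw [PathClass.comp_assoc, PathClass.edge_comp_edge_bar _ _ rfl, PathClass.comp_of_one]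

theorem tip_bar_mk {x : Γ.carrier} {v w : Γ.Vert} (hw : Γ.tip (Γ.bar x) = w) (hv : Γ.tip x = v)
    (γ : PathClass G p w) :
    (tree G p).tip ((tree G p).bar (TreeCell.mk x hv (γ.comp (PathClass.edge x hw hv)))) =
      treeVert γ := by
  rw [bar_mk_comp_edge]
  rfl

/-- The tree is connected. -/
theorem nonempty_path_tree {a b : Γ.Vert} (γ : GPath G a b) (σ : PathClass G p a) :
    Nonempty (GPath (GraphOfGroups.trivial (tree G p)) (treeVert σ)
      (treeVert (σ.comp (PathClass.mk γ)))) := by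
  induction γ with
  | base g => exact ⟨(GPath.base 1 : GPath _ (treeVert σ) (treeVert σ)).copy rfl
      (treeVert_comp_of σ g).symm⟩
  | cons g x ha hb γ ih =>
    let ρ := σ.comp (PathClass.of g)
    obtain ⟨θ⟩ := ih (ρ.comp (PathClass.edge x ha hb))
    have e : (ρ.comp (PathClass.edge x ha hb)).comp (PathClass.mk γ) =
        σ.comp (PathClass.mk (GPath.cons g x ha hb γ)) := by
      rw [PathClass.comp_assoc, PathClass.comp_assoc]
      congr 1
      change PathClass.mk (GPath.cons (g * 1) _ _ _ (GPath.lmul 1 _)) = _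
      rw [mul_one, GPath.lmul_one]
    -- The group element `g` does not move the vertex `σ G_a`; it only selects which edge over `x`
    -- starts the lifted path.
    refine ⟨(GPath.cons 1 (TreeCell.mk x hb (ρ.comp (PathClass.edge x ha hb)))
      (tip_bar_mk ha hb ρ) (tip_mk hb _) θ).copy (treeVert_comp_of σ g) (congrArg treeVert e)⟩

theorem nonempty_path_treeRoot (w : (tree G p).Vert) :
    Nonempty (GPath (GraphOfGroups.trivial (tree G p)) (treeRoot G p) w) := by
  obtain ⟨v, γ, rfl⟩ := exists_eq_treeVert w
  induction γ using PathClass.ind with | _ γ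
  have h := nonempty_path_tree γ (PathClass.of (G := G) (a := p) 1)
  rwa [PathClass.of_one_comp] at h

/-- Cells over the same vertex or edge with the same endpoints are equal. -/
theorem TreeCell.ext_of_endpoints {t t' : (tree G p).carrier}
    (h : (treeProj G p).toFun t = (treeProj G p).toFun t')
    (h₀ : (tree G p).τ ((tree G p).bar t) = (tree G p).τ ((tree G p).bar t'))
    (h₁ : (tree G p).τ t = (tree G p).τ t') : t = t' := by
  obtain ⟨x, hx⟩ : ∃ x, (treeProj G p).toFun t = x := ⟨_, rfl⟩
  obtain ⟨γ, rfl⟩ := TreeCell.exists_eq_mk t hx rfl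
  obtain ⟨γ', rfl⟩ := TreeCell.exists_eq_mk t' (h.symm.trans hx) rfl
  -- Equal terminal vertices give `γ' = γ g`. Equal initial vertices then give some `k` with `k x =
  -- x g`, and Britton's lemma puts `g` in the image of `ι x`.
  obtain ⟨g, rfl⟩ := exists_of_treeVert_eq (Subtype.ext (h₁ : (treeVert γ).1 = (treeVert γ').1))
  have hx : Γ.tip (Γ.bar (Γ.bar x)) = Γ.tip x := congrArg Γ.tip (Γ.bar_bar x)
  obtain ⟨k, hk⟩ := exists_of_treeVert_eq (Subtype.ext (h₀ : (treeVert (γ.comp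
    (PathClass.edge (Γ.bar x) hx rfl))).1 = (treeVert _).1))
  rw [PathClass.comp_assoc, PathClass.comp_assoc] at hk
  have hk := PathClass.comp_left_cancel _ hk
  have e : (PathClass.of k).comp (PathClass.edge x rfl rfl) =
      (PathClass.edge x rfl rfl : PathClass G _ _).comp (PathClass.of g) := by
    apply PathClass.comp_left_cancel (PathClass.edge (Γ.bar x) hx rfl)
    rw [← PathClass.comp_assoc, ← PathClass.comp_assoc, ← hk, PathClass.comp_assoc,
      PathClass.edge_comp_edge_bar _ _ (Γ.bar_bar x).symm, PathClass.of_one_comp,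
      PathClass.comp_of_one]
  obtain ⟨k', rfl⟩ := exists_ι_eq_of_comp_edge x rfl rfl rfl e
  exact (TreeCell.sound x rfl rfl γ k').symm

/-- The start is a variable `a` equal to the root so that this applies to paths `ft η`, whose start
equals the root only through the hypothesis `root`. -/
theorem IsCoveringProjection.vert_eq {π : Morphism (GraphOfGroups.trivial (tree G p)) G}
    (hπ : IsCoveringProjection p π) {a w : (tree G p).Vert} (ha : a = treeRoot G p)
    (η : GPath (GraphOfGroups.trivial (tree G p)) a w) {v : Γ.Vert} (hv : π.graph.vert w = v)
    (ha' : π.graph.vert a = p) :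
    w = treeVert ((PathClass.mk (π.mapPath η)).copy ha' hv) := by
  subst ha hv
  have := hπ.lift w.1 ((tree G p).tip_vert w) η
  rw [π.δ_vert, PathClass.comp_of_one] at this
  exact Subtype.ext this

end Tree

/-! ### The lift of a morphism: existence, uniqueness, equivariance -/

section Lift

variable {Λ : GerstenGraph.{u₁}} {Γ : GerstenGraph.{u₂}}
  {L : GraphOfGroups.{u₁, v₁} Λ} {G : GraphOfGroups.{u₂, v₂} Γ} {p : Λ.Vert} {q : Γ.Vert}
  {πΛ : Morphism (GraphOfGroups.trivial (tree L p)) L}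
  {πΓ : Morphism (GraphOfGroups.trivial (tree G q)) G}

/-- The path `πΓ (ft η)` represents the vertex at which `ft η` ends, and `f (πΛ η)` represents the
same vertex by the hypothesis `vert`. Two representatives of one vertex differ by an element of its
vertex group, which is the path condition. -/
theorem IsLift.of_vert (hπΛ : IsCoveringProjection p πΛ) (hπΓ : IsCoveringProjection q πΓ)
    {f : Morphism L G} {ft : GraphHom (tree L p) (tree G q)} (hpq : f.graph.vert p = q)
    (root : ft.vert (treeRoot L p) = treeRoot G q)
    (proj : ∀ t, (treeProj G q).toFun (ft.toFun t) = f.graph.toFun ((treeProj L p).toFun t))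
    (vert : ∀ {w : Λ.Vert} (σ : PathClass L p w),
      ft.vert (treeVert σ) = treeVert ((f.mapClass σ).copy hpq rfl)) :
    IsLift πΛ πΓ f ft := by
  have square : ∀ t, πΓ.graph.toFun (ft.toFun t) = f.graph.toFun (πΛ.graph.toFun t) := by
    rw [hπΛ.graph, hπΓ.graph]; exact proj
  refine ⟨root, square, fun w η => ?_⟩
  have h1 := hπΛ.vert_eq rfl η rfl (vert_treeRoot hπΛ.graph)
  have h2 := hπΓ.vert_eq root (ft.toMorphism.mapPath η) (vert_eq_of_square square w)
    ((congrArg πΓ.graph.vert root).trans (vert_treeRoot hπΓ.graph))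
  have h3 := vert ((PathClass.mk (πΛ.mapPath η)).copy (vert_treeRoot hπΛ.graph) rfl)
  rw [← h1] at h3
  obtain ⟨g, hg⟩ := exists_of_treeVert_eq (h3.symm.trans h2)
  refine ⟨g, PathClass.exact ?_⟩
  have e0 : f.graph.vert (πΛ.graph.vert (treeRoot L p)) = q :=
    (congrArg f.graph.vert (vert_treeRoot hπΛ.graph)).trans hpq
  refine (PathClass.mk_copy _ _ _).trans ((PathClass.copy_congr_left (ha := e0) (hb := rfl)).1 ?_)
  refine (PathClass.copy_copy _ _ _ _ _).trans (hg.trans ?_)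
  rw [← PathClass.mk_comp, PathClass.comp_copy]
  refine (congrArg (PathClass.comp · _) ?_)
  have key : ∀ {a p' : Λ.Vert} (h : a = p') (e : f.graph.vert p' = q)
      (e' : f.graph.vert a = q) {w : Λ.Vert} (γ : PathClass L a w),
      (f.mapClass (γ.copy h rfl)).copy e rfl = (f.mapClass γ).copy e' rfl := by
    rintro a _ rfl _ _ _ _; rfl
  exact key _ _ e0 _

/-- A path `η` from the root to `w` exists, and the path condition makes `f (πΛ η)`, which does not
involve the lift, a representative of the image of `w`. -/
theorem IsLift.vert_eq (hπΓ : IsCoveringProjection q πΓ)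
    {f : Morphism L G} {ft ft' : GraphHom (tree L p) (tree G q)}
    (h : IsLift πΛ πΓ f ft) (h' : IsLift πΛ πΓ f ft') (w : (tree L p).Vert) :
    ft.vert w = ft'.vert w := by
  obtain ⟨η⟩ := nonempty_path_treeRoot w
  have e0 : f.graph.vert (πΛ.graph.vert (treeRoot L p)) = q := by
    rw [← vert_eq_of_square h.square, h.root, vert_treeRoot hπΓ.graph]
  have key : ∀ {ft : GraphHom (tree L p) (tree G q)}, IsLift πΛ πΓ f ft →
      ft.vert w = treeVert ((PathClass.mk (f.mapPath (πΛ.mapPath η))).copy e0 rfl) := by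
    intro ft h
    obtain ⟨g, hg⟩ := h.path w η
    have h2 := hπΓ.vert_eq h.root (ft.toMorphism.mapPath η) (vert_eq_of_square h.square w)
      ((congrArg πΓ.graph.vert h.root).trans (vert_treeRoot hπΓ.graph))
    have h3 := (PathClass.mk_copy _ _ _).symm.trans (PathClass.sound hg)
    have h4 := (PathClass.copy_congr_left (ha := e0) (hb := rfl)).2 h3
    have h5 := (PathClass.copy_copy _ _ _ _ _).symm.trans h4
    rw [← PathClass.mk_comp, PathClass.comp_copy] at h5
    exact h2.trans ((congrArg treeVert h5).trans (treeVert_comp_of _ g))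
  rw [key h, key h']

theorem IsLift.unique (hπΓ : IsCoveringProjection q πΓ)
    {f : Morphism L G} {ft ft' : GraphHom (tree L p) (tree G q)}
    (h : IsLift πΛ πΓ f ft) (h' : IsLift πΛ πΓ f ft') : ft = ft' := by
  refine GraphHom.ext (funext fun t => TreeCell.ext_of_endpoints ?_ ?_ ?_)
  · rw [← hπΓ.graph, h.square, h'.square]
  · rw [← ft.map_bar, ← ft'.map_bar, ← ft.map_τ, ← ft'.map_τ]
    exact congrArg Subtype.val (h.vert_eq hπΓ h' ((tree L p).tip ((tree L p).bar t)))
  · rw [← ft.map_τ, ← ft'.map_τ]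
    exact congrArg Subtype.val (h.vert_eq hπΓ h' ((tree L p).tip t))

namespace Morphism

theorem mapClass_comp (f : Morphism L G) {a b c : Λ.Vert} (γ : PathClass L a b)
    (η : PathClass L b c) : f.mapClass (γ.comp η) = (f.mapClass γ).comp (f.mapClass η) := by
  induction γ using PathClass.ind with | _ γ
  induction η using PathClass.ind with | _ η
  exact congrArg PathClass.mk (f.mapPath_append γ η)

theorem mapClass_of (f : Morphism L G) {a : Λ.Vert} (g : L.grp a.cell) :
    f.mapClass (PathClass.of g) = PathClass.of (f.vhom a g) := rfl

theorem mapClass_edge (f : Morphism L G) {a b : Λ.Vert} (x : Λ.carrier)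
    (ha : Λ.tip (Λ.bar x) = a) (hb : Λ.tip x = b) :
    f.mapClass (PathClass.edge x ha hb) = (PathClass.of (f.δ (Λ.bar x) ha)).comp
      ((PathClass.edge (f.graph.toFun x) (f.graph.tip_bar_map ha) (f.graph.tip_map hb)).comp
        (PathClass.of (f.δ x hb)⁻¹)) := by
  have h := f.mk_mapPath_cons 1 x ha hb (GPath.base 1)
  have e : PathClass.mk (f.mapPath (GPath.base (1 : L.grp b.cell))) =
    PathClass.of (f.vhom b 1) := rfl
  rw [e, map_one, map_one, PathClass.comp_of_one, PathClass.of_one_comp] at h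
  exact h

/-- The lift of `f` to Bass–Serre trees: `γ L_x ↦ f(γ) δ_x G_{f x}`. -/
def lift (f : Morphism L G) (p : Λ.Vert) :
    GraphHom (tree L p) (tree G (f.graph.vert p)) where
  toFun := Quot.lift (fun a => TreeCell.mk (f.graph.toFun a.x) (f.graph.tip_map a.hv)
      ((f.mapClass a.γ).comp (PathClass.of (f.δ a.x a.hv)))) (by
    rintro _ _ ⟨x, hc, hv, γ, h⟩
    dsimp only
    -- By pseudonaturality `f(γ ι_x(h)) δ_x = f(γ) δ_x ι_{f x}(f_c h)`, which lies in the same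
    -- coset.
    have e : f.vhom _ (L.ι x hc hv h) = _ := f.pseudonatural x hc hv h
    rw [mapClass_comp, mapClass_of, e, PathClass.comp_assoc, PathClass.of_comp_of,
      inv_mul_cancel_right, ← PathClass.of_comp_of, ← PathClass.comp_assoc, TreeCell.sound])
  map_bar t := by
    induction t using TreeCell.ind with | _ x v hv γ
    have hv' : Λ.tip (Λ.bar (Λ.bar x)) = v := (congrArg Λ.tip (Λ.bar_bar x)).trans hv
    refine Eq.trans ?_ (TreeCell.bar_mk (f.graph.map_bar x) (f.graph.tip_map hv)
      (f.graph.tip_bar_map hv') (f.graph.tip_map rfl) _).symm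
    refine congrArg (TreeCell.mk _ _) ?_
    -- Since `f(x̄) = δ_x (f x̄) δ_x̄⁻¹`, the trailing `δ_x̄` cancels and leaves `f(γ) δ_x (f x̄)`.
    change (f.mapClass (γ.comp (PathClass.edge _ hv' rfl))).comp _ = _
    rw [mapClass_comp, mapClass_edge, PathClass.comp_assoc, PathClass.comp_assoc,
      PathClass.comp_assoc, PathClass.comp_assoc, PathClass.of_comp_of, inv_mul_cancel,
      PathClass.comp_of_one, f.δ_congr (Λ.bar_bar x) hv' hv]
  map_τ t := by
    induction t using TreeCell.ind with | _ x v hv γ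
    refine Eq.trans ?_ (TreeCell.mk_comp_of (f.mapClass γ) (f.δ x hv)).symm
    change TreeCell.mk _ _ ((f.mapClass γ).comp (PathClass.of (f.δ v.1 (Λ.tip_vert v)))) = _
    rw [f.δ_vert, PathClass.comp_of_one]
    rfl

theorem lift_vert (f : Morphism L G) {w : Λ.Vert} (σ : PathClass L p w) :
    (f.lift p).vert (treeVert σ) = treeVert (f.mapClass σ) := by
  refine Subtype.ext ?_
  change TreeCell.mk _ _ ((f.mapClass σ).comp (PathClass.of (f.δ w.1 (Λ.tip_vert w)))) = _
  rw [f.δ_vert, PathClass.comp_of_one]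
  rfl

theorem isEquivariant_lift (f : Morphism L G) :
    IsEquivariant (f.piOne (p := p) rfl) (f.lift p) := by
  intro g t
  induction t using TreeCell.ind with | _ x v hv γ
  change TreeCell.mk _ _ ((f.mapClass (g.comp γ)).comp _) =
    TreeCell.mk _ _ ((f.mapClass g).comp ((f.mapClass γ).comp _))
  rw [mapClass_comp, PathClass.comp_assoc]

theorem exists_isLift (hπΛ : IsCoveringProjection p πΛ) (hπΓ : IsCoveringProjection q πΓ)
    (f : Morphism L G) (hpq : f.graph.vert p = q) :
    ∃ ft : GraphHom (tree L p) (tree G q),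
      IsLift πΛ πΓ f ft ∧ IsEquivariant (f.piOne hpq) ft := by
  subst hpq
  refine ⟨f.lift p, IsLift.of_vert hπΛ hπΓ rfl ?_ ?_ fun σ => f.lift_vert σ,
    f.isEquivariant_lift⟩
  · refine (f.lift_vert (PathClass.of (G := L) (a := p) 1)).trans ?_
    rw [mapClass_of, map_one]
    rfl
  · intro t
    induction t using TreeCell.ind with | _ x v hv γ
    rfl

end Morphism

end Lift

theorem GerstenGraph.eq_or_eq_bar_of_cell_eq {Γ : GerstenGraph.{u}} {x y : Γ.carrier}
    (h : Γ.cell x = Γ.cell y) : x = y ∨ x = Γ.bar y := by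
  have key : ∀ a b, Relation.EqvGen (fun x y => y = Γ.bar x) a b → a = b ∨ a = Γ.bar b := by
    intro a b hab
    induction hab with
    | rel a b h => exact .inr (by rw [h, Γ.bar_bar])
    | refl a => exact .inl rfl
    | symm a b _ ih =>
      rcases ih with h | h
      · exact .inl h.symm
      · exact .inr (by rw [h, Γ.bar_bar])
    | trans a b c _ _ ih ih' =>
      rcases ih with rfl | rfl <;> rcases ih' with rfl | rfl <;> simp [Γ.bar_bar]
  exact key _ _ (Quot.eqvGen_exact h)

theorem GerstenGraph.Connected.nonempty_pathClass {Γ : GerstenGraph.{u}} (hΓ : Γ.Connected)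
    (G : GraphOfGroups.{u, v} Γ) (a b : Γ.Vert) : Nonempty (PathClass G a b) := by
  induction hΓ a b with
  | refl => exact ⟨PathClass.of 1⟩
  | tail _ h ih =>
    obtain ⟨x, ha, hb⟩ := h
    obtain ⟨γ⟩ := ih
    exact ⟨γ.comp (PathClass.edge x ha hb)⟩

section Copy

variable {Γ : GerstenGraph.{u}} {G : GraphOfGroups.{u, v} Γ}

theorem PathClass.comp_of_one_copy {a b b' : Γ.Vert} (h : b = b') (γ : PathClass G a b) :
    γ.comp ((of 1).copy rfl h) = γ.copy rfl h := by
  subst h; exact comp_of_one γ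

theorem PathClass.of_one_copy_comp {a a' b : Γ.Vert} (h : a' = a) (γ : PathClass G a' b) :
    ((of 1).copy rfl h.symm).comp γ = γ.copy h rfl := by
  subst h; exact of_one_comp γ

end Copy

/-! ### From an equivariant tree map to a morphism of graphs of groups -/

section Descent

variable {Λ : GerstenGraph.{u₁}} {Γ : GerstenGraph.{u₂}}
  {L : GraphOfGroups.{u₁, v₁} Λ} {G : GraphOfGroups.{u₂, v₂} Γ} {p : Λ.Vert} {q : Γ.Vert}

/-- Two cells over the same `x` differ by an element of `π₁(Λ, L, p)`; by equivariance their images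
differ by an element of `π₁(Γ, G, q)`, which the projection forgets. -/
theorem IsEquivariant.exists_graphHom (hΛ : Λ.Connected) {φ : PiOne L p →* PiOne G q}
    {ft : GraphHom (tree L p) (tree G q)} (h : IsEquivariant φ ft) :
    ∃ g : GraphHom Λ Γ,
      ∀ t, (treeProj G q).toFun (ft.toFun t) = g.toFun ((treeProj L p).toFun t) := by
  let γ := fun v => Classical.choice (hΛ.nonempty_pathClass L p v)
  have hsmul : ∀ (g : PiOne G q) (t : (tree G q).carrier),
      (treeProj G q).toFun (g • t) = (treeProj G q).toFun t := by
    intro g t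
    induction t using TreeCell.ind
    rfl
  let g₀ : Λ.carrier → Γ.carrier := fun x =>
    (treeProj G q).toFun (ft.toFun (TreeCell.mk x rfl (γ (Λ.tip x))))
  have key : ∀ t, (treeProj G q).toFun (ft.toFun t) = g₀ ((treeProj L p).toFun t) := by
    intro t
    obtain ⟨σ, ht⟩ := TreeCell.exists_eq_mk t rfl rfl
    have e : t = (σ.comp (γ _).inv : PiOne L p) •
        (show (tree L p).carrier from
          TreeCell.mk ((treeProj L p).toFun t) rfl (γ (Λ.tip ((treeProj L p).toFun t)))) := by
      rw [TreeCell.smul_mk _ _ _ rfl, PathClass.comp_assoc, PathClass.inv_comp,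
        PathClass.comp_of_one]
      exact ht
    conv_lhs => rw [e]
    rw [h, hsmul]
  have hlift : ∀ x, ∃ t, (treeProj L p).toFun t = x := fun x =>
    ⟨TreeCell.mk x rfl (γ _), rfl⟩
  refine ⟨⟨g₀, fun x => ?_, fun x => ?_⟩, key⟩
  · obtain ⟨t, rfl⟩ := hlift x
    rw [← (treeProj L p).map_bar, ← key, ← key, ft.map_bar, (treeProj G q).map_bar]
  · obtain ⟨t, rfl⟩ := hlift x
    rw [← (treeProj L p).map_τ, ← key, ← key, ft.map_τ, (treeProj G q).map_τ]

/-- A map of path groupoids over the graph morphism `g` that is compatible with the map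
`ft` of Bass–Serre trees and with the homomorphism `φ`. The map `F` lifts the action of `ft`
on cosets to paths starting at the basepoint. -/
structure PathLift (φ : PiOne L p →* PiOne G q) (ft : GraphHom (tree L p) (tree G q))
    (g : GraphHom Λ Γ) where
  hpq : g.vert p = q
  F : ∀ {a : Λ.Vert}, PathClass L p a → PathClass G q (g.vert a)
  T : ∀ {a b : Λ.Vert}, PathClass L a b → PathClass G (g.vert a) (g.vert b)
  F_comp : ∀ {a b : Λ.Vert} (σ : PathClass L p a) (τ : PathClass L a b),
    F (σ.comp τ) = (F σ).comp (T τ)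
  F_smul : ∀ {a : Λ.Vert} (h : PiOne L p) (σ : PathClass L p a),
    F (h.comp σ) = (φ h).comp (F σ)
  F_one : F (PathClass.of 1) = (PathClass.of 1).copy rfl hpq.symm
  T_comp : ∀ {a b c : Λ.Vert} (σ : PathClass L a b) (τ : PathClass L b c),
    T (σ.comp τ) = (T σ).comp (T τ)
  map_treeVert : ∀ {a : Λ.Vert} (σ : PathClass L p a), ft.vert (treeVert σ) = treeVert (F σ)

open Classical in
theorem IsEquivariant.nonempty_pathLift (hΛ : Λ.Connected) {φ : PiOne L p →* PiOne G q}
    {ft : GraphHom (tree L p) (tree G q)} (h : IsEquivariant φ ft)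
    (root : ft.vert (treeRoot L p) = treeRoot G q) {g : GraphHom Λ Γ}
    (hg : ∀ t, (treeProj G q).toFun (ft.toFun t) = g.toFun ((treeProj L p).toFun t)) :
    Nonempty (PathLift φ ft g) := by
  have hpq : g.vert p = q := by
    refine Subtype.ext ((hg (treeRoot L p).1).symm.trans ?_)
    exact congrArg (fun w => (treeProj G q).toFun w.1) root
  -- At the basepoint both choices are the trivial path. This normalisation gives `F_one`, and
  -- through it the fact that `T` restricts to `φ` on loops at `p`.
  have hex : ∀ v, ∃ (γ : PathClass L p v) (β : PathClass G q (g.vert v)),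
      ft.vert (treeVert γ) = treeVert β ∧ ∀ e : v = p, γ = (PathClass.of 1).copy rfl e.symm ∧
        β = (PathClass.of 1).copy rfl (hpq.symm.trans (congrArg g.vert e.symm)) := by
    intro v
    by_cases hv : v = p
    · subst hv
      refine ⟨PathClass.of 1, (PathClass.of 1).copy rfl hpq.symm, ?_, fun _ => ⟨rfl, rfl⟩⟩
      refine root.trans ?_
      have : ∀ {v : Γ.Vert} (e : q = v), treeRoot G q =
          treeVert ((PathClass.of (G := G) (a := q) 1).copy rfl e) := by
        rintro _ rfl; rfl
      exact this _
    · obtain ⟨γ⟩ := hΛ.nonempty_pathClass L p v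
      obtain ⟨β, hβ⟩ := TreeCell.exists_eq_mk (ft.toFun (treeVert γ).1)
        (hg _) (Γ.tip_vert (g.vert v))
      exact ⟨γ, β, Subtype.ext hβ, fun e => (hv e).elim⟩
  choose γ β hγβ hone using hex
  have hcomp : ∀ x y : PiOne L p, φ (x.comp y) = (φ x).comp (φ y) := map_mul φ
  have hφ1 : φ (PathClass.of 1) = PathClass.of 1 := map_one φ
  refine ⟨{
    hpq := hpq
    -- Here `σ γ_a⁻¹` is a loop at `p`, so `φ` applies to it. In particular `F γ_a = β_a`, and
    -- `F_comp` then forces the formula for `T`.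
    F := fun {a} σ => (φ (σ.comp (γ a).inv)).comp (β a)
    T := fun {a b} τ => (β a).inv.comp ((φ (((γ a).comp τ).comp (γ b).inv)).comp (β b))
    F_comp := fun {a b} σ τ => ?_
    F_smul := fun h σ => ?_
    F_one := ?_
    T_comp := fun {a b c} σ τ => ?_
    map_treeVert := fun {a} σ => ?_ }⟩
  · rw [PathClass.comp_assoc (φ _), PathClass.comp_inv_comp, ← PathClass.comp_assoc (φ _),
      ← hcomp]
    simp only [PathClass.comp_assoc, PathClass.inv_comp_comp]
  · rw [PathClass.comp_assoc, hcomp, PathClass.comp_assoc]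
  · have h1 : γ p = PathClass.of 1 := (hone p rfl).1
    rw [(hone p rfl).2, ← h1, PathClass.comp_inv, hφ1, PathClass.of_one_comp]
  · simp only [PathClass.comp_assoc, PathClass.comp_inv_comp]
    rw [← PathClass.comp_assoc (φ _) (φ _), ← hcomp]
    simp only [PathClass.comp_assoc, PathClass.inv_comp_comp]
  · have e : (treeVert σ).1 = (σ.comp (γ a).inv : PiOne L p) • (treeVert (γ a)).1 := by
      rw [TreeCell.smul_mk _ _ _ (treeVert_val (γ a)), PathClass.comp_assoc, PathClass.inv_comp,
        PathClass.comp_of_one]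
      rfl
    refine Subtype.ext ?_
    change ft.toFun (treeVert σ).1 = _
    rw [e, h]
    change _ • (ft.vert (treeVert (γ a))).1 = _
    rw [hγβ, TreeCell.smul_mk _ _ _ (treeVert_val (β a))]
    rfl

namespace PathLift

variable {φ : PiOne L p →* PiOne G q} {ft : GraphHom (tree L p) (tree G q)} {g : GraphHom Λ Γ}
  (P : PathLift φ ft g)

theorem T_one (a : Λ.Vert) : P.T (PathClass.of (1 : L.grp a.cell)) = PathClass.of 1 := by
  apply PathClass.comp_left_cancel (P.T (PathClass.of (1 : L.grp a.cell)))
  rw [← P.T_comp, PathClass.comp_of_one, PathClass.comp_of_one]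

theorem copy_T_eq_F {a : Λ.Vert} (σ : PathClass L p a) : (P.T σ).copy P.hpq rfl = P.F σ := by
  rw [← PathClass.of_one_copy_comp, ← P.F_one, ← P.F_comp, PathClass.of_one_comp]

theorem copy_T_eq_φ (σ : PiOne L p) : (P.T σ).copy P.hpq P.hpq = φ σ := by
  have h := P.F_smul σ (PathClass.of 1)
  rw [PathClass.comp_of_one, P.F_one, PathClass.comp_of_one_copy, ← P.copy_T_eq_F] at h
  have h' := congrArg (fun γ => PathClass.copy γ rfl P.hpq) h
  rw [PathClass.copy_copy, PathClass.copy_copy] at h'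
  exact h'

/-- The element `d` describes the image under `ft` of the cells of the tree over `x`. -/
def IsTwist (x : Λ.carrier) {v : Λ.Vert} (hv : Λ.tip x = v) (d : G.grp (g.vert v).cell) : Prop :=
  ∀ σ : PathClass L p v, ft.toFun (TreeCell.mk x hv σ) =
    TreeCell.mk (g.toFun x) (g.tip_map hv) ((P.F σ).comp (PathClass.of d))

variable {P}

/-- One `σ` suffices: all others are translates of it by loops at `p`, and both sides are
equivariant. -/
theorem IsTwist.of_eq (h : IsEquivariant φ ft) {x : Λ.carrier} {v : Λ.Vert} {hv : Λ.tip x = v}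
    {d : G.grp (g.vert v).cell} (σ : PathClass L p v)
    (hσ : ft.toFun (TreeCell.mk x hv σ) =
      TreeCell.mk (g.toFun x) (g.tip_map hv) ((P.F σ).comp (PathClass.of d))) :
    P.IsTwist x hv d := by
  intro σ'
  obtain ⟨k, rfl⟩ : ∃ k : PiOne L p, σ' = k.comp σ :=
    ⟨σ'.comp σ.inv, by rw [PathClass.comp_assoc, PathClass.inv_comp, PathClass.comp_of_one]⟩
  refine (congrArg ft.toFun (TreeCell.smul_mk k hv σ rfl).symm).trans
    ((h k _).trans ((TreeCell.smul_mk _ _ _ hσ).trans ?_))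
  rw [← PathClass.comp_assoc, P.F_smul]

theorem exists_eq_F_comp {x : Λ.carrier} {v : Λ.Vert} (hv : Λ.tip x = v) {σ : PathClass L p v}
    {β : PathClass G q (g.vert v)}
    (h : ft.toFun (TreeCell.mk x hv σ) = TreeCell.mk (g.toFun x) (g.tip_map hv) β) :
    ∃ d, β = (P.F σ).comp (PathClass.of d) := by
  apply exists_of_treeVert_eq
  rw [← P.map_treeVert]
  exact Subtype.ext ((ft.map_τ _).trans (congrArg (tree G q).τ h))

variable (P)

theorem isTwist_vert (v : Λ.Vert) : P.IsTwist v.1 (Λ.tip_vert v) 1 := by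
  intro σ
  rw [PathClass.comp_of_one]
  exact congrArg Subtype.val (P.map_treeVert σ)

theorem exists_isTwist (hΛ : Λ.Connected) (h : IsEquivariant φ ft)
    (hg : ∀ t, (treeProj G q).toFun (ft.toFun t) = g.toFun ((treeProj L p).toFun t))
    (x : Λ.carrier) {v : Λ.Vert} (hv : Λ.tip x = v) : ∃ d, P.IsTwist x hv d := by
  obtain ⟨σ⟩ := hΛ.nonempty_pathClass L p v
  obtain ⟨β, hβ⟩ := TreeCell.exists_eq_mk (ft.toFun (TreeCell.mk x hv σ)) (hg _) (g.tip_map hv)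
  obtain ⟨d, rfl⟩ := P.exists_eq_F_comp hv hβ
  exact ⟨d, .of_eq h σ hβ⟩

/-- `IsTwist` fixes an element only up to the image of the edge group, so elements for `x` and `bar
x` cannot be chosen independently. The element `d'` is the one with `T(x) = d (g x) d'⁻¹`, the
formula by which a morphism acts on an edge. -/
theorem exists_isTwist_of_bar (hΛ : Λ.Connected) (h : IsEquivariant φ ft) (x : Λ.carrier)
    {a b : Λ.Vert} (ha : Λ.tip (Λ.bar x) = a) (hb : Λ.tip x = b) {d : G.grp (g.vert a).cell}
    (hd : P.IsTwist (Λ.bar x) ha d) :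
    ∃ d', P.IsTwist x hb d' ∧
      (PathClass.of d).comp (PathClass.edge (g.toFun x) (g.tip_bar_map ha) (g.tip_map hb)) =
        (P.T (PathClass.edge x ha hb)).comp (PathClass.of d') := by
  obtain ⟨σ⟩ := hΛ.nonempty_pathClass L p a
  have e : ft.toFun (TreeCell.mk x hb (σ.comp (PathClass.edge x ha hb))) =
      TreeCell.mk (g.toFun x) (g.tip_map hb) (((P.F σ).comp (PathClass.of d)).comp
        (PathClass.edge (g.toFun x) (g.tip_bar_map ha) (g.tip_map hb))) := by
    have h1 := (ft.map_bar _).symm.trans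
      ((congrArg ft.toFun (bar_mk_comp_edge ha hb σ)).trans (hd σ))
    have h2 := congrArg (tree G q).bar h1
    rw [(tree G q).bar_bar] at h2
    refine h2.trans (TreeCell.bar_mk ?_ _ _ _ _)
    rw [g.map_bar, Γ.bar_bar]
  obtain ⟨d', hd'⟩ := P.exists_eq_F_comp hb e
  refine ⟨d', .of_eq h _ (hd' ▸ e), ?_⟩
  rw [P.F_comp, PathClass.comp_assoc, PathClass.comp_assoc] at hd'
  exact PathClass.comp_left_cancel _ hd'

open Classical in
theorem exists_δ (hΛ : Λ.Connected) (h : IsEquivariant φ ft)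
    (hg : ∀ t, (treeProj G q).toFun (ft.toFun t) = g.toFun ((treeProj L p).toFun t)) :
    ∃ δ : ∀ (x : Λ.carrier) (v : Λ.Vert), Λ.tip x = v → G.grp (g.vert v).cell,
      (∀ v, δ v.1 v (Λ.tip_vert v) = 1) ∧ (∀ x v hv, P.IsTwist x hv (δ x v hv)) ∧
      ∀ x a b ha hb, (PathClass.of (δ (Λ.bar x) a ha)).comp
          (PathClass.edge (g.toFun x) (g.tip_bar_map ha) (g.tip_map hb)) =
        (P.T (PathClass.edge x ha hb)).comp (PathClass.of (δ x b hb)) := by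
  have h0 : ∀ (x : Λ.carrier) (v : Λ.Vert) (hv : Λ.tip x = v),
      ∃ d, P.IsTwist x hv d ∧ (x = v.1 → d = 1) := by
    intro x v hv
    by_cases hx : x = v.1
    · subst hx
      exact ⟨1, P.isTwist_vert v, fun _ => rfl⟩
    · obtain ⟨d, hd⟩ := P.exists_isTwist hΛ h hg x hv
      exact ⟨d, hd, fun e => (hx e).elim⟩
  choose d₀ hd₀ hd₀_vert using h0
  choose d₁ hd₁ hd₁_edge using fun (x : Λ.carrier) (v : Λ.Vert) (hv : Λ.tip x = v) =>
    P.exists_isTwist_of_bar hΛ h x rfl hv (hd₀ (Λ.bar x) _ rfl)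
  -- An orientation: each edge pair has one preferred member. There `δ` is the free choice `d₀`; on
  -- the reversed edge it is the `d₁` that this choice dictates.
  let o : Λ.carrier → Λ.carrier := fun x => Quot.out (Λ.cell x)
  have ho_bar : ∀ x, o (Λ.bar x) = o x := fun x => congrArg Quot.out (Λ.cell_bar x)
  have ho : ∀ x, o x = x ∨ o x = Λ.bar x := fun x =>
    GerstenGraph.eq_or_eq_bar_of_cell_eq (Quot.out_eq (Λ.cell x))
  let δ : ∀ (x : Λ.carrier) (v : Λ.Vert), Λ.tip x = v → G.grp (g.vert v).cell :=
    fun x v hv => if o x = x then d₀ x v hv else d₁ x v hv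
  have hδ₀ : ∀ x v hv, o x = x → δ x v hv = d₀ x v hv := fun x v hv hx => if_pos hx
  have hδ₁ : ∀ x a b ha hb, o x ≠ x → (PathClass.of (d₀ (Λ.bar x) a ha)).comp
        (PathClass.edge (g.toFun x) (g.tip_bar_map ha) (g.tip_map hb)) =
      (P.T (PathClass.edge x ha hb)).comp (PathClass.of (δ x b hb)) := by
    rintro x _ b rfl hb hx
    have : δ x b hb = d₁ x b hb := if_neg hx
    rw [this]
    exact hd₁_edge x b hb
  have hd₀_congr : ∀ {x y : Λ.carrier} (_ : x = y) {v : Λ.Vert} (hx : Λ.tip x = v)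
      (hy : Λ.tip y = v), d₀ x v hx = d₀ y v hy := by
    rintro x _ rfl _ _ _; rfl
  have hδ_vert : ∀ x v hv, x = v.1 → δ x v hv = 1 := by
    intro x v hv hx
    have hox : o x = x := by
      rcases ho x with h | h
      · exact h
      · rw [h, hx, v.2]
    rw [hδ₀ x v hv hox, hd₀_vert x v hv hx]
  refine ⟨δ, fun v => hδ_vert _ _ _ rfl, fun x v hv => ?_, fun x a b ha hb => ?_⟩
  · by_cases hx : o x = x
    · rw [hδ₀ x v hv hx]; exact hd₀ x v hv
    · have : δ x v hv = d₁ x v hv := if_neg hx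
      rw [this]; exact hd₁ x v hv
  · by_cases hbar : Λ.bar x = x
    · obtain ⟨w, rfl⟩ : ∃ w : Λ.Vert, w.1 = x := ⟨⟨x, hbar⟩, rfl⟩
      obtain rfl : w = b := (Λ.tip_vert w).symm.trans hb
      obtain rfl : a = w := ha.symm.trans ((congrArg Λ.tip hbar).trans hb)
      rw [hδ_vert _ _ ha a.2, hδ_vert _ _ hb rfl, PathClass.edge_of_vertex a.2, P.T_one,
        PathClass.edge_of_vertex (x := g.toFun a.1) (g.vert a).2]
    · by_cases hx : o x = x
      · have hx' : o (Λ.bar x) ≠ Λ.bar x := by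
          rw [ho_bar, hx]; exact Ne.symm hbar
        have hb' : Λ.tip (Λ.bar (Λ.bar x)) = b := (congrArg Λ.tip (Λ.bar_bar x)).trans hb
        have e := hδ₁ (Λ.bar x) b a hb' ha hx'
        rw [hd₀_congr (Λ.bar_bar x) hb' hb, ← hδ₀ x b hb hx] at e
        -- For a preferred edge the relation is the one already known for its reverse, with the two
        -- edges inverted.
        apply PathClass.comp_right_cancel (PathClass.edge (g.toFun (Λ.bar x))
          (g.tip_bar_map hb') (g.tip_map ha))
        rw [PathClass.comp_assoc, PathClass.comp_assoc, e, ← PathClass.comp_assoc (P.T _),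
          ← P.T_comp, PathClass.edge_comp_edge_bar _ _ rfl, P.T_one, PathClass.of_one_comp,
          PathClass.edge_comp_edge_bar _ _ (g.map_bar x), PathClass.comp_of_one]
      · have hx' : o (Λ.bar x) = Λ.bar x := by
          rw [ho_bar]; exact (ho x).resolve_left hx
        rw [hδ₀ _ _ _ hx']
        exact hδ₁ x a b ha hb hx

/-- The classes `σ` and `σ ι_x(h)` give the same cell over `x`, so `F(σ) d` and `F(σ) T(ι_x h) d`
give the same cell over `g x`; hence `T(ι_x h)` lies in `d ι(G) d⁻¹`. Multiplicativity follows
because `ι` and `PathClass.of` are injective. -/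
theorem IsTwist.exists_hom (hΛ : Λ.Connected) {x : Λ.carrier} {c : Λ.Cell} {v : Λ.Vert}
    (hc : Λ.cell x = c) {hv : Λ.tip x = v} {d : G.grp (g.vert v).cell}
    (hd : P.IsTwist x hv d) :
    ∃ k : L.grp c →* G.grp (g.cell c), ∀ h, P.T (PathClass.of (L.ι x hc hv h)) =
      PathClass.of (d * G.ι (g.toFun x) (g.cell_map hc) (g.tip_map hv) (k h) * d⁻¹) := by
  have hex : ∀ h : L.grp c, ∃ k : G.grp (g.cell c), P.T (PathClass.of (L.ι x hc hv h)) =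
      PathClass.of (d * G.ι (g.toFun x) (g.cell_map hc) (g.tip_map hv) k * d⁻¹) := by
    intro h
    obtain ⟨σ⟩ := hΛ.nonempty_pathClass L p v
    have e := congrArg ft.toFun (TreeCell.sound x hc hv σ h)
    rw [hd, hd] at e
    obtain ⟨k, hk⟩ := TreeCell.exact (g.cell_map hc) (g.tip_map hv) e.symm
    rw [P.F_comp, PathClass.comp_assoc, PathClass.comp_assoc] at hk
    refine ⟨k, PathClass.comp_right_cancel (PathClass.of d) ?_⟩
    rw [PathClass.comp_left_cancel _ hk, PathClass.of_comp_of, PathClass.of_comp_of,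
      inv_mul_cancel_right]
  choose k hk using hex
  refine ⟨MonoidHom.mk' k fun h h' => ?_, hk⟩
  have e := hk (h * h')
  rw [map_mul, ← PathClass.of_comp_of, P.T_comp, hk, hk, PathClass.of_comp_of] at e
  have e' := PathClass.of_injective e
  apply G.ι_injective (g.toFun x) (g.cell_map hc) (g.tip_map hv)
  apply mul_left_cancel (a := d)
  apply mul_right_cancel (b := d⁻¹)
  rw [← e', map_mul]
  group

theorem exists_hom (hΛ : Λ.Connected)
    {δ : ∀ (x : Λ.carrier) (v : Λ.Vert), Λ.tip x = v → G.grp (g.vert v).cell}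
    (hδ : ∀ x v hv, P.IsTwist x hv (δ x v hv))
    (hedge : ∀ x a b ha hb, (PathClass.of (δ (Λ.bar x) a ha)).comp
          (PathClass.edge (g.toFun x) (g.tip_bar_map ha) (g.tip_map hb)) =
        (P.T (PathClass.edge x ha hb)).comp (PathClass.of (δ x b hb))) (c : Λ.Cell) :
    ∃ k : L.grp c →* G.grp (g.cell c), ∀ (x : Λ.carrier) (v : Λ.Vert) (hc : Λ.cell x = c)
      (hv : Λ.tip x = v) (h : L.grp c), P.T (PathClass.of (L.ι x hc hv h)) =
        PathClass.of (δ x v hv * G.ι (g.toFun x) (g.cell_map hc) (g.tip_map hv) (k h) *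
          (δ x v hv)⁻¹) := by
  obtain ⟨x, hx⟩ : ∃ x, Λ.cell x = c := Quot.exists_rep c
  obtain ⟨k, hk⟩ := IsTwist.exists_hom P hΛ hx (hδ x _ rfl)
  refine ⟨k, fun y v hc hv h => ?_⟩
  rcases GerstenGraph.eq_or_eq_bar_of_cell_eq (hc.trans hx.symm) with rfl | rfl
  · subst hv; exact hk h
  -- The homomorphism found from `x` must also serve `bar x`. After multiplying by `T(x) δ_x`, the
  -- slide relation for `x` in `L`, the edge relation, and the slide relation for `g x` in `G` turn
  -- one side into the other.
  · refine PathClass.comp_right_cancel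
      ((P.T (PathClass.edge x hv rfl)).comp (PathClass.of (δ x _ rfl))) ?_
    rw [← PathClass.comp_assoc, ← P.T_comp, ← PathClass.slide x hx hv rfl h, P.T_comp,
      PathClass.comp_assoc, hk, PathClass.of_comp_of, inv_mul_cancel_right,
      ← PathClass.of_comp_of, ← PathClass.comp_assoc, ← hedge, PathClass.comp_assoc,
      PathClass.slide, ← PathClass.comp_assoc, ← PathClass.comp_assoc, PathClass.of_comp_of,
      PathClass.of_comp_of, inv_mul_cancel_right,
      G.ι_congr (g.map_bar x) _ (g.tip_map hv) _ (g.tip_bar_map hv)]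

/-- A map of Bass–Serre trees equivariant with respect to a homomorphism of fundamental groups
comes from a morphism of graphs of groups. -/
theorem exists_morphism (hΛ : Λ.Connected) (h : IsEquivariant φ ft)
    (hg : ∀ t, (treeProj G q).toFun (ft.toFun t) = g.toFun ((treeProj L p).toFun t)) :
    ∃ (f : Morphism L G) (e : f.graph = g), ∀ {a b : Λ.Vert} (σ : PathClass L a b),
      (f.mapClass σ).copy (by rw [e]) (by rw [e]) = P.T σ := by
  obtain ⟨δ, hδ_vert, hδ, hedge⟩ := P.exists_δ hΛ h hg
  choose k hk using P.exists_hom hΛ hδ hedge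
  -- At a vertex both `δ` and the conjugation disappear, so `T` on a vertex group is the
  -- homomorphism `k` itself.
  have hkv : ∀ (v : Λ.Vert) (m : L.grp v.cell),
      P.T (PathClass.of m) = PathClass.of (k v.cell m : G.grp (g.vert v).cell) := by
    intro v m
    have e := hk v.cell v.1 v rfl (Λ.tip_vert v) m
    rw [hδ_vert, one_mul, inv_one, mul_one] at e
    refine Eq.trans ?_ (e.trans ?_)
    · exact congrArg (fun m => P.T (PathClass.of m)) (L.ι_vert_apply v _ _ m).symm
    · exact congrArg PathClass.of (G.ι_vert_apply (g.vert v) _ _ _)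
  let f : Morphism L G :=
    { graph := g
      hom := k
      δ := fun x {v} hv => δ x v hv
      δ_vert := hδ_vert
      -- The identity is known for classes of paths and descends to the vertex group because that
      -- group embeds.
      pseudonatural := fun x c v hc hv m =>
        PathClass.of_injective ((hkv v _).symm.trans (hk c x v hc hv m)) }
  refine ⟨f, rfl, fun {a b} σ => ?_⟩
  change f.mapClass σ = P.T σ
  induction σ using PathClass.ind with | _ σ
  induction σ with
  | base m => exact (hkv _ m).symm
  | @cons a b c m x ha hb σ ih =>
    have e : PathClass.mk (GPath.cons m x ha hb σ) =
        (PathClass.of m).comp ((PathClass.edge x ha hb).comp (PathClass.mk σ)) := by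
      change _ = PathClass.mk (GPath.cons (m * 1) _ _ _ (GPath.lmul 1 _))
      rw [mul_one, GPath.lmul_one]
    -- On an edge, `f` gives `δ_x̄ (g x) δ_x⁻¹`, which is `T(x)` by `hedge`.
    have e' : f.mapClass (PathClass.edge x ha hb) = P.T (PathClass.edge x ha hb) := by
      refine (f.mapClass_edge x ha hb).trans ?_
      rw [← PathClass.comp_assoc]
      refine (congrArg (PathClass.comp · _) (hedge x a b ha hb)).trans ?_
      refine (PathClass.comp_assoc _ _ _).trans ?_
      refine (congrArg (PathClass.comp _ ·) ((PathClass.of_comp_of _ _).trans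
        (congrArg PathClass.of (mul_inv_cancel _)))).trans ?_
      exact PathClass.comp_of_one _
    rw [e, f.mapClass_comp, f.mapClass_comp, P.T_comp, P.T_comp, e', ih]
    exact congrArg (PathClass.comp · _) (hkv _ m).symm

end PathLift

theorem IsEquivariant.exists_isLift {πΛ : Morphism (GraphOfGroups.trivial (tree L p)) L}
    {πΓ : Morphism (GraphOfGroups.trivial (tree G q)) G} (hΛ : Λ.Connected)
    (hπΛ : IsCoveringProjection p πΛ) (hπΓ : IsCoveringProjection q πΓ)
    {φ : PiOne L p →* PiOne G q} {ft : GraphHom (tree L p) (tree G q)}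
    (root : ft.vert (treeRoot L p) = treeRoot G q) (h : IsEquivariant φ ft) :
    ∃ (f : Morphism L G) (hpq : f.graph.vert p = q), f.piOne hpq = φ ∧ IsLift πΛ πΓ f ft := by
  obtain ⟨g, hg⟩ := h.exists_graphHom hΛ
  obtain ⟨P⟩ := h.nonempty_pathLift hΛ root hg
  obtain ⟨f, rfl, hf⟩ := P.exists_morphism hΛ h hg
  have hf' : ∀ {a b : Λ.Vert} (σ : PathClass L a b), f.mapClass σ = P.T σ := hf
  refine ⟨f, P.hpq, MonoidHom.ext fun σ => ?_, IsLift.of_vert hπΛ hπΓ P.hpq root hg fun σ => ?_⟩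
  · change (f.mapClass σ).copy P.hpq P.hpq = φ σ
    rw [hf', P.copy_T_eq_φ]
  · rw [hf', P.copy_T_eq_F, P.map_treeVert]

end Descent

end BassSerre

theorem mainTheorem10
    {Λ : BassSerre.GerstenGraph.{u₁}} {Γ : BassSerre.GerstenGraph.{u₂}}
    (hΛ : Λ.Connected) (hΓ : Γ.Connected)
    (L : BassSerre.GraphOfGroups.{u₁, v₁} Λ) (G : BassSerre.GraphOfGroups.{u₂, v₂} Γ)
    (p : Λ.Vert) (q : Γ.Vert)
    (πΛ : BassSerre.Morphism (BassSerre.GraphOfGroups.trivial (BassSerre.tree L p)) L)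
    (hπΛ : BassSerre.IsCoveringProjection p πΛ)
    (πΓ : BassSerre.Morphism (BassSerre.GraphOfGroups.trivial (BassSerre.tree G q)) G)
    (hπΓ : BassSerre.IsCoveringProjection q πΓ) :
    (∀ (f : BassSerre.Morphism L G) (hpq : f.graph.vert p = q),
      ∃ ft : BassSerre.GraphHom (BassSerre.tree L p) (BassSerre.tree G q),
        BassSerre.IsLift πΛ πΓ f ft ∧
        BassSerre.IsEquivariant (f.piOne hpq) ft ∧
        ∀ ft' : BassSerre.GraphHom (BassSerre.tree L p) (BassSerre.tree G q),
          BassSerre.IsLift πΛ πΓ f ft' → ft' = ft) ∧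
    (∀ (φ : BassSerre.PiOne L p →* BassSerre.PiOne G q)
      (ft : BassSerre.GraphHom (BassSerre.tree L p) (BassSerre.tree G q)),
      ft.vert (BassSerre.treeRoot L p) = BassSerre.treeRoot G q →
      BassSerre.IsEquivariant φ ft →
      ∃ (f : BassSerre.Morphism L G) (hpq : f.graph.vert p = q),
        f.piOne hpq = φ ∧ BassSerre.IsLift πΛ πΓ f ft) := by
  refine ⟨fun f hpq => ?_, fun φ ft root h => h.exists_isLift hΛ hπΛ hπΓ root⟩
  obtain ⟨ft, hft, heq⟩ := BassSerre.Morphism.exists_isLift hπΛ hπΓ f hpq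
  exact ⟨ft, hft, heq, fun ft' hft' => hft'.unique hπΓ hft⟩
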